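/- Let $G$ be a finite simple plane graph: its vertices are finitely many distinct points of $\mathbb R^2$, and its edges are simple arcs joining distinct vertices, at most one for each pair of vertices, such that no edge passes through a vertex other than its two ends and two distinct edges meet only in common end vertices. Assume that $G$ is $2$-connected, i.e. $G$ has at least three vertices, is connected, and remains connected after the deletion of any single vertex. The faces of a plane graph are the connected components of the complement of its point set in $\mathbb R^2$; the outer face is the unbounded one. A vertex is exterior if it lies on the boundary of the outer face. A Hamiltonian circle is a circle (cycle) of the graph containing all vertices. A finite, possibly empty, sequence of edges $(e_1,\dots,e_k)$ of $G$, with $G_0:=G$ and $G_t:=G-\{e_1,\dots,e_t\}$ (edges are deleted, all vertices and the embedding of the other edges are kept), is a co-Hamiltonian edge sequence if for each $t=1,\dots,k$ 1. $e_t$ is an edge of $G_{t-1}$ lying on the boundary of the outer face of $G_{t-1}$, and 2. $G_t$ is $2$-connected, and if in the final graph $G_k$ every vertex is exterior and $G_k$ contains exactly one Hamiltonian circle (as a subgraph). The co-Hamiltonian face sequence induced by it is $(F_1,\dots,F_k)$, where $F_t$ is the bounded face of $G_{t-1}$ that becomes part of the outer face of $G_t$ when $e_t$ is deleted. Then $G$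 contains a Hamiltonian circle if and only if $G$ admits a co-Hamiltonian face sequence, i.e. there is a co-Hamiltonian edge sequence together with the face sequence it induces. -/

import Mathlib

/-- The Euclidean plane. -/
abbrev Plane : Type := EuclideanSpace ℝ (Fin 2)

/-- `A` is a (simple, topological) arc in the plane with end points `x` and `y`: the image of an
injective continuous map of the unit interval that starts at `x` and ends at `y`. -/
def IsArc (A : Set Plane) (x y : Plane) : Prop :=
  ∃ γ : unitInterval → Plane, Continuous γ ∧ Function.Injective γ ∧
    γ 0 = x ∧ γ 1 = y ∧ Set.range γ = A

/-- A simple plane graph with vertex set `V`: an abstract simple graph together with a drawing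
without crossings. Only the values of `arc` at edges of `graph` matter. -/
structure PlaneGraph (V : Type*) where
  /-- the underlying abstract graph -/
  graph : SimpleGraph V
  /-- the point that represents a vertex -/
  pos : V → Plane
  /-- the arc that represents an edge, end points included -/
  arc : Sym2 V → Set Plane
  pos_injective : Function.Injective pos
  arc_isArc : ∀ u v : V, graph.Adj u v → IsArc (arc s(u, v)) (pos u) (pos v)
  /-- an edge passes through no vertices except its two ends -/
  mem_of_pos_mem_arc : ∀ e ∈ graph.edgeSet, ∀ w : V, pos w ∈ arc e → w ∈ e
  /-- distinct edges meet only in vertices -/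
  arc_inter_subset : ∀ e ∈ graph.edgeSet, ∀ f ∈ graph.edgeSet, e ≠ f →
    arc e ∩ arc f ⊆ Set.range pos

namespace PlaneGraph

variable {V : Type*}

/-- The point set of the plane graph: all its vertices and all points of its edges. -/
def carrier (G : PlaneGraph V) : Set Plane :=
  Set.range G.pos ∪ ⋃ e ∈ G.graph.edgeSet, G.arc e

/-- The faces are the connected components of the complement of the point set. -/
def IsFace (G : PlaneGraph V) (F : Set Plane) : Prop :=
  ∃ x ∈ G.carrierᶜ, F = connectedComponentIn G.carrierᶜ x

/-- A bounded face. -/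
def IsBoundedFace (G : PlaneGraph V) (F : Set Plane) : Prop :=
  G.IsFace F ∧ Bornology.IsBounded F

/-- The outer face: the points off the graph whose face is unbounded. (The point set of a finite
plane graph is compact, so there is exactly one unbounded face.) -/
def outerFace (G : PlaneGraph V) : Set Plane :=
  {x | x ∈ G.carrierᶜ ∧ ¬ Bornology.IsBounded (connectedComponentIn G.carrierᶜ x)}

/-- `e` is an edge that lies on the boundary of the outer face. -/
def IsOuterEdge (G : PlaneGraph V) (e : Sym2 V) : Prop :=
  e ∈ G.graph.edgeSet ∧ G.arc e ⊆ frontier G.outerFace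

/-- `v` is an exterior vertex: it is incident with the outer face. -/
def IsExterior (G : PlaneGraph V) (v : V) : Prop :=
  G.pos v ∈ frontier G.outerFace

/-- The plane graph `G - s`, in the inherited drawing, for a set `s` of edges. All vertices are
kept. -/
def deleteEdges (G : PlaneGraph V) (s : Set (Sym2 V)) : PlaneGraph V where
  graph := G.graph.deleteEdges s
  pos := G.pos
  arc := G.arc
  pos_injective := G.pos_injective
  arc_isArc u v h := G.arc_isArc u v (SimpleGraph.deleteEdges_le s h)
  mem_of_pos_mem_arc e he :=
    G.mem_of_pos_mem_arc e (SimpleGraph.edgeSet_mono (SimpleGraph.deleteEdges_le s) he)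
  arc_inter_subset e he f hf :=
    G.arc_inter_subset e (SimpleGraph.edgeSet_mono (SimpleGraph.deleteEdges_le s) he)
      f (SimpleGraph.edgeSet_mono (SimpleGraph.deleteEdges_le s) hf)

/-- The plane graph that is left after the deletion of the first `t` edges of the sequence `E`. -/
def after (G : PlaneGraph V) (E : List (Sym2 V)) (t : ℕ) : PlaneGraph V :=
  G.deleteEdges {e | e ∈ E.take t}

end PlaneGraph

/-- A graph is `2`-connected if it has at least three vertices, is connected, and stays connected
when any one vertex is deleted. -/
structure SimpleGraph.IsTwoConnected {V : Type*} (G : SimpleGraph V) : Prop where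
  three_le_card : 3 ≤ ENat.card V
  connected : G.Connected
  connected_delete : ∀ v : V, (G.induce {v}ᶜ).Connected

/-- The subgraph `C` is a Hamiltonian circle of `G`. -/
def SimpleGraph.IsHamiltonianCircle {V : Type*} [DecidableEq V] (G : SimpleGraph V)
    (C : G.Subgraph) : Prop :=
  ∃ (a : V) (p : G.Walk a a), p.IsHamiltonianCycle ∧ C = p.toSubgraph

namespace PlaneGraph

variable {V : Type*} [DecidableEq V]

/-- Co-Hamiltonian edge sequences `E = (e₁, …, eₖ)` of `G`. The list is indexed from `0`, so
`E[t]` is the edge deleted from `G.after E t` to obtain `G.after E (t + 1)`. -/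
structure IsCoHamiltonianEdgeSeq (G : PlaneGraph V) (E : List (Sym2 V)) : Prop where
  /-- each edge lies on the boundary of the outer face when it is deleted -/
  outer : ∀ (t : ℕ) (ht : t < E.length), (G.after E t).IsOuterEdge E[t]
  /-- the graph remains `2`-connected after each deletion -/
  twoConnected : ∀ t < E.length, (G.after E (t + 1)).graph.IsTwoConnected
  /-- in the final graph every vertex is exterior -/
  exterior : ∀ v : V, (G.after E E.length).IsExterior v
  /-- the final graph contains exactly one Hamiltonian circle -/
  unique : ∃! C : (G.after E E.length).graph.Subgraph,
    (G.after E E.length).graph.IsHamiltonianCircle C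

/-- `L = (F₁, …, Fₖ)` is the face sequence induced by the edge sequence `E = (e₁, …, eₖ)`: the
`t`-th face is the bounded face of the graph before the `t`-th deletion that becomes part of the
outer face by this deletion. -/
structure IsInducedFaceSeq (G : PlaneGraph V) (E : List (Sym2 V)) (L : List (Set Plane)) :
    Prop where
  length_eq : L.length = E.length
  bounded : ∀ (t : ℕ) (ht : t < L.length), (G.after E t).IsBoundedFace L[t]
  merged : ∀ (t : ℕ) (ht : t < L.length), L[t] ⊆ (G.after E (t + 1)).outerFace

/-- `L` is a co-Hamiltonian (face) sequence of `G`. -/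
def IsCoHamiltonianFaceSeq (G : PlaneGraph V) (L : List (Set Plane)) : Prop :=
  ∃ E : List (Sym2 V), G.IsCoHamiltonianEdgeSeq E ∧ G.IsInducedFaceSeq E L

end PlaneGraph

/-! Fix a Hamiltonian cycle and delete, one at a time, outer edges that do not lie on it. The cycle
survives, so every intermediate graph is Hamiltonian and therefore 2-connected. The process stops at
a graph whose outer edges all lie on the cycle. Conversely, a Hamiltonian circle of the final graph
is one of `G`, since only edges were deleted.

Three topological facts carry the forward direction. Deleting an outer edge whose ends stay joined
by a path merges a bounded face into the outer face (`exists_isBoundedFace_subset`): edge and path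
form a closed curve, which separates the plane, while the path alone does not. In the final graph
each cycle edge is outer, since otherwise the outer boundary would lie in a path
(`isOuterEdge_of_isPath`); hence all vertices are exterior. Finally, chords of the cycle cannot
cross (`false_of_crossing`). A second Hamiltonian cycle would contain a chord `uv`, and the rest of
it would have to pass between the two sides of `uv` by an edge crossing that chord
(`toSubgraph_eq_of_isHamiltonianCycle`).

The topology rests on Eilenberg's criterion instead of the Jordan curve theorem: points `p`, `q` off
a compact set `X` lie in one component of the complement exactly when `(z - p) / (z - q)` has a
continuous logarithm on `X`. Logarithms on two closed sets, or two open sets, glue when the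
intersection is connected. This shows that arcs and paths do not separate, that closed curves do,
and that an edge lies on a face boundary as soon as one inner point does. -/

/-- The plane as the complex line. -/
noncomputable def Plane.toComplex : Plane ≃ₗᵢ[ℝ] ℂ := Complex.orthonormalBasisOneI.repr.symm

theorem Plane.norm_toComplex_sub (z w : Plane) :
    ‖Plane.toComplex z - Plane.toComplex w‖ = dist z w := by
  rw [← map_sub, LinearIsometryEquiv.norm_map, dist_eq_norm]

theorem Plane.toComplex_sub_ne_zero {z w : Plane} (h : z ≠ w) :
    Plane.toComplex z - Plane.toComplex w ≠ 0 :=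
  sub_ne_zero.2 (Plane.toComplex.injective.ne h)

/-! ### Continuous logarithms: gluing and lifting -/

/-- `g` has a continuous logarithm on `X`. -/
def HasLogOn {Y : Type*} [TopologicalSpace Y] (X : Set Y) (g : Y → ℂ) : Prop :=
  ∃ f : Y → ℂ, ContinuousOn f X ∧ ∀ z ∈ X, Complex.exp (f z) = g z

section HasLogOn

variable {Y : Type*} [TopologicalSpace Y] {X X' : Set Y} {g h : Y → ℂ}

theorem HasLogOn.mono (hg : HasLogOn X g) (hX : X' ⊆ X) : HasLogOn X' g := by
  obtain ⟨f, hf, hfg⟩ := hg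
  exact ⟨f, hf.mono hX, fun z hz => hfg z (hX hz)⟩

theorem HasLogOn.congr (hg : HasLogOn X g) (hgh : ∀ z ∈ X, g z = h z) : HasLogOn X h := by
  obtain ⟨f, hf, hfg⟩ := hg
  exact ⟨f, hf, fun z hz => (hfg z hz).trans (hgh z hz)⟩

theorem HasLogOn.mul (hg : HasLogOn X g) (hh : HasLogOn X h) :
    HasLogOn X (fun z => g z * h z) := by
  obtain ⟨f, hf, hfg⟩ := hg
  obtain ⟨f', hf', hfg'⟩ := hh
  exact ⟨fun z => f z + f' z, hf.add hf', fun z hz => by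
    rw [Complex.exp_add, hfg z hz, hfg' z hz]⟩

theorem HasLogOn.inv (hg : HasLogOn X g) : HasLogOn X (fun z => (g z)⁻¹) := by
  obtain ⟨f, hf, hfg⟩ := hg
  exact ⟨fun z => -f z, hf.neg, fun z hz => by rw [Complex.exp_neg, hfg z hz]⟩

theorem hasLogOn_one : HasLogOn X (fun _ => 1) :=
  ⟨fun _ => 0, continuousOn_const, fun _ _ => Complex.exp_zero⟩

theorem hasLogOn_of_slitPlane (hg : ContinuousOn g X) (hs : ∀ z ∈ X, g z ∈ Complex.slitPlane) :
    HasLogOn X g :=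
  ⟨fun z => Complex.log (g z), hg.clog hs, fun z hz =>
    Complex.exp_log (Complex.slitPlane_ne_zero (hs z hz))⟩

/-- Two continuous logarithms on a preconnected set differ by a constant. -/
theorem IsPreconnected.exists_eq_add_of_exp_eq {f f' : Y → ℂ} (hX : IsPreconnected X)
    (hf : ContinuousOn f X) (hf' : ContinuousOn f' X)
    (h : ∀ z ∈ X, Complex.exp (f z) = Complex.exp (f' z)) :
    ∃ c : ℂ, Complex.exp c = 1 ∧ ∀ z ∈ X, f z = f' z + c := by
  rcases X.eq_empty_or_nonempty with rfl | ⟨x, hx⟩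
  · exact ⟨0, Complex.exp_zero, by simp⟩
  refine ⟨f x - f' x, by rw [Complex.exp_sub, h x hx, div_self (Complex.exp_ne_zero _)], ?_⟩
  intro z hz
  have key : ∀ w ∈ X, ∃ n : ℤ, f w - f' w = n * (2 * Real.pi * Complex.I) := by
    intro w hw
    obtain ⟨n, hn⟩ := Complex.exp_eq_exp_iff_exists_int.1 (h w hw)
    exact ⟨n, by rw [hn]; ring⟩
  -- The imaginary part divided by `2π` is continuous with values in the discrete set of integers,
  -- hence constant on `X`.
  have him : ∀ w ∈ X, ∃ n : ℤ, (n : ℝ) = (f w - f' w).im / (2 * Real.pi) := by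
    intro w hw
    obtain ⟨n, hn⟩ := key w hw
    refine ⟨n, ?_⟩
    rw [hn, eq_div_iff (by positivity)]
    simp
  have hc : ContinuousOn (fun w => (f w - f' w).im / (2 * Real.pi)) X :=
    (Complex.continuous_im.comp_continuousOn (hf.sub hf')).div_const _
  have hd : IsDiscrete (Set.range ((↑) : ℤ → ℝ)) :=
    ⟨Int.isClosedEmbedding_coe_real.isEmbedding.toHomeomorph.symm.isEmbedding.discreteTopology⟩
  have := hX.constant_of_mapsTo hd hc (fun w hw => him w hw) hz hx
  obtain ⟨n, hn⟩ := key z hz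
  obtain ⟨m, hm⟩ := key x hx
  have hnm : (f z - f' z).im = (f x - f' x).im := by
    have hpi : (2 * Real.pi) ≠ 0 := by positivity
    field_simp at this
    exact this
  have : f z - f' z = f x - f' x := by
    apply Complex.ext _ hnm
    rw [hn, hm]; simp
  rw [← this]; ring

-- The two logarithms differ by a constant on the connected overlap; shifting the second by it makes
-- them agree there.
open Classical in
theorem HasLogOn.exists_union (hA : HasLogOn X g) (hB : HasLogOn X' g)
    (hAB : IsPreconnected (X ∩ X')) :
    ∃ f : Y → ℂ, ContinuousOn f X ∧ ContinuousOn f X' ∧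
      ∀ z ∈ X ∪ X', Complex.exp (f z) = g z := by
  obtain ⟨f, hf, hfg⟩ := hA
  obtain ⟨f', hf', hfg'⟩ := hB
  obtain ⟨c, hc, hcf⟩ := hAB.exists_eq_add_of_exp_eq (hf.mono Set.inter_subset_left)
    (hf'.mono Set.inter_subset_right) (fun z hz => (hfg z hz.1).trans (hfg' z hz.2).symm)
  refine ⟨X.piecewise f (fun z => f' z + c), hf.congr fun z hz => ?_,
    (hf'.add (continuousOn_const (c := c))).congr fun z hz => ?_, fun z hz => ?_⟩
  · simp [hz]
  · by_cases h : z ∈ X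
    · simpa [h] using hcf z ⟨h, hz⟩
    · simp [h]
  · by_cases h : z ∈ X
    · simpa [h] using hfg z h
    · simpa [h, Complex.exp_add, hc] using hfg' z (hz.resolve_left h)

theorem HasLogOn.union_of_isClosed (hA : HasLogOn X g) (hB : HasLogOn X' g)
    (hX : IsClosed X) (hX' : IsClosed X') (hAB : IsPreconnected (X ∩ X')) :
    HasLogOn (X ∪ X') g := by
  obtain ⟨f, h1, h2, h3⟩ := hA.exists_union hB hAB
  exact ⟨f, h1.union_of_isClosed h2 hX hX', h3⟩

theorem HasLogOn.union_of_isOpen (hA : HasLogOn X g) (hB : HasLogOn X' g)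
    (hX : IsOpen X) (hX' : IsOpen X') (hAB : IsPreconnected (X ∩ X')) :
    HasLogOn (X ∪ X') g := by
  obtain ⟨f, h1, h2, h3⟩ := hA.exists_union hB hAB
  exact ⟨f, h1.union_of_isOpen h2 hX hX', h3⟩

/-- A homotopy in the punctured plane starting at the constant `1` lifts through the covering `exp`,
starting from `0`; the end of the lift is the logarithm. -/
theorem exists_continuousMap_exp_eq_of_homotopy (H : C(unitInterval × Y, ℂ))
    (hH : ∀ x, H x ≠ 0) (h0 : ∀ y, H (0, y) = 1) :
    ∃ L : C(Y, ℂ), ∀ y, Complex.exp (L y) = H (1, y) := by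
  let H' : C(unitInterval × Y, {z : ℂ // z ≠ 0}) :=
    ⟨fun x => ⟨H x, hH x⟩, H.continuous.subtype_mk _⟩
  have hH0 : ∀ y, H' (0, y) = ⟨_, Complex.exp_ne_zero (ContinuousMap.const Y (0 : ℂ) y)⟩ :=
    fun y => Subtype.ext (by simp [H', h0 y])
  let L := Complex.isCoveringMap_exp.liftHomotopy H' (ContinuousMap.const Y 0) hH0
  refine ⟨⟨fun y => L (1, y), by fun_prop⟩, fun y => ?_⟩
  have := congrFun (Complex.isCoveringMap_exp.liftHomotopy_lifts H' (ContinuousMap.const Y 0) hH0)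
    (1, y)
  exact congrArg Subtype.val this

end HasLogOn

/-- Contracting the plane radially to `0` deforms `g / g 0` to `1`. -/
theorem hasLogOn_univ_plane {g : Plane → ℂ} (hg : Continuous g) (h0 : ∀ z, g z ≠ 0) :
    HasLogOn Set.univ g := by
  let H : C(unitInterval × Plane, ℂ) := ⟨fun x => g ((x.1 : ℝ) • x.2) / g 0, by fun_prop⟩
  obtain ⟨L, hL⟩ := exists_continuousMap_exp_eq_of_homotopy H
    (fun x => div_ne_zero (h0 _) (h0 _)) (fun y => by simp [H, h0])
  refine ⟨fun z => L z + Complex.log (g 0), by fun_prop, fun z _ => ?_⟩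
  rw [Complex.exp_add, hL, Complex.exp_log (h0 _)]
  simp [H, h0]

/-- The arc contracts along its parameter to its starting point. -/
theorem IsArc.hasLogOn {A : Set Plane} {x y : Plane} (hA : IsArc A x y) {g : Plane → ℂ}
    (hg : ContinuousOn g A) (h0 : ∀ z ∈ A, g z ≠ 0) : HasLogOn A g := by
  classical
  obtain ⟨γ, hγ, hinj, -, -, rfl⟩ := hA
  have hgγ : Continuous (g ∘ γ) := hg.comp_continuous hγ (fun t => Set.mem_range_self t)
  let H : C(unitInterval × unitInterval, ℂ) :=
    ⟨fun s => (g ∘ γ) (s.1 * s.2) / g (γ 0),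
      (hgγ.comp (continuous_fst.mul continuous_snd)).div_const _⟩
  obtain ⟨L, hL⟩ := exists_continuousMap_exp_eq_of_homotopy H
    (fun x => div_ne_zero (h0 _ ⟨_, rfl⟩) (h0 _ ⟨_, rfl⟩)) (fun y => by simp [H, h0])
  let e := (hγ.isClosedEmbedding hinj).isEmbedding.toHomeomorph
  refine ⟨fun z => if h : z ∈ Set.range γ then L (e.symm ⟨z, h⟩) + Complex.log (g (γ 0)) else 0,
    ?_, fun z hz => ?_⟩
  · rw [continuousOn_iff_continuous_domRestrict]
    have : Continuous fun z : Set.range γ => L (e.symm z) + Complex.log (g (γ 0)) := by fun_prop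
    convert this using 1
    ext z
    have := z.2
    simp only [Set.domRestrict_apply, dif_pos this]
  · obtain ⟨t, rfl⟩ := hz
    have he : e.symm ⟨γ t, Set.mem_range_self t⟩ = t := by
      rw [Homeomorph.symm_apply_eq]; rfl
    simp [Complex.exp_add, hL, Complex.exp_log (h0 (γ 0) ⟨_, rfl⟩), he, H,
      h0 (γ 0) ⟨_, rfl⟩]

theorem IsArc.isCompact {A : Set Plane} {x y : Plane} (hA : IsArc A x y) : IsCompact A := by
  obtain ⟨γ, hγ, hinj, -, -, rfl⟩ := hA
  exact isCompact_range hγ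

theorem IsArc.left_mem {A : Set Plane} {x y : Plane} (hA : IsArc A x y) : x ∈ A := by
  obtain ⟨γ, hγ, hinj, h, -, rfl⟩ := hA
  exact ⟨0, h⟩

theorem IsArc.right_mem {A : Set Plane} {x y : Plane} (hA : IsArc A x y) : y ∈ A := by
  obtain ⟨γ, hγ, hinj, -, h, rfl⟩ := hA
  exact ⟨1, h⟩

/-- Sliding the pole from one end to the other along the arc is a homotopy that never vanishes off
the arc. -/
theorem IsArc.hasLogOn_compl {A : Set Plane} {x y : Plane} (hA : IsArc A x y) :
    HasLogOn Aᶜ (fun z => (Plane.toComplex z - Plane.toComplex x) /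
      (Plane.toComplex z - Plane.toComplex y)) := by
  classical
  obtain ⟨γ, hγ, hinj, rfl, rfl, rfl⟩ := hA
  have hne : ∀ (t : unitInterval) (z : ↥(Set.range γ)ᶜ),
      Plane.toComplex z - Plane.toComplex (γ t) ≠ 0 := fun t z =>
    Plane.toComplex_sub_ne_zero fun h => z.2 ⟨t, h.symm⟩
  let H : C(unitInterval × ↥(Set.range γ)ᶜ, ℂ) :=
    ⟨fun s => (Plane.toComplex s.2 - Plane.toComplex (γ s.1)) /
      (Plane.toComplex s.2 - Plane.toComplex (γ 0)), by
        refine Continuous.div ?_ ?_ fun s => hne 0 s.2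
        · exact (Plane.toComplex.continuous.comp (continuous_subtype_val.comp continuous_snd)).sub
            (Plane.toComplex.continuous.comp (hγ.comp continuous_fst))
        · exact (Plane.toComplex.continuous.comp (continuous_subtype_val.comp continuous_snd)).sub
            continuous_const⟩
  obtain ⟨L, hL⟩ := exists_continuousMap_exp_eq_of_homotopy H
    (fun s => div_ne_zero (hne _ _) (hne _ _)) (fun z => div_self (hne _ _))
  refine ⟨fun z => if h : z ∈ (Set.range γ)ᶜ then -L ⟨z, h⟩ else 0, ?_, fun z hz => ?_⟩
  · rw [continuousOn_iff_continuous_domRestrict]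
    have : Continuous fun z : ↥(Set.range γ)ᶜ => -L z := by fun_prop
    convert this using 1
    ext z
    have := z.2
    simp only [Set.domRestrict_apply, dif_pos this]
  · simp only [dif_pos hz, Complex.exp_neg, hL]
    simp [H]

/-- There is no continuous logarithm of `z - p` on a circle around `p`. -/
theorem not_hasLogOn_sphere (p : Plane) {r : ℝ} (hr : 0 < r) :
    ¬ HasLogOn (Metric.sphere p r) (fun z => Plane.toComplex z - Plane.toComplex p) := by
  rintro ⟨f, hf, hfg⟩
  let γ : ℝ → Plane := fun t => p + Plane.toComplex.symm (r * Complex.exp (t * Complex.I))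
  have hγ : Continuous γ := by
    refine continuous_const.add (Plane.toComplex.symm.continuous.comp ?_)
    fun_prop
  have hm : ∀ t, γ t ∈ Metric.sphere p r := by
    intro t
    simp [γ, Complex.norm_exp_ofReal_mul_I, abs_of_pos hr]
  obtain ⟨c, -, hc⟩ := isPreconnected_univ.exists_eq_add_of_exp_eq
    (f := fun t : ℝ => f (γ t)) (f' := fun t : ℝ => Real.log r + t * Complex.I)
    (hf.comp_continuous hγ hm).continuousOn (by fun_prop) (fun t _ => by
      rw [hfg _ (hm t), Complex.exp_add, ← Complex.ofReal_exp, Real.exp_log hr]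
      simp [γ])
  -- Along the parametrised circle the logarithm must be `log r + it` up to a constant, which takes
  -- different values at `0` and `2π`.
  have h0 := hc 0 trivial
  have h1 := hc (2 * Real.pi) trivial
  have : γ (2 * Real.pi) = γ 0 := by simp [γ, Complex.exp_two_pi_mul_I]
  rw [this, h0] at h1
  have := congrArg Complex.im h1
  simp [Real.pi_ne_zero] at this

/-! ### Eilenberg's criterion for separation in the plane -/

/-- The points `p` and `q` are not separated by `X`, in the sense of Eilenberg's criterion. -/
def LogEquivOn (X : Set Plane) (p q : Plane) : Prop :=
  HasLogOn X (fun z => (Plane.toComplex z - Plane.toComplex p) /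
    (Plane.toComplex z - Plane.toComplex q))

namespace LogEquivOn

variable {X : Set Plane} {p q r : Plane}

theorem refl (hp : p ∉ X) : LogEquivOn X p p :=
  hasLogOn_one.congr fun _ hz =>
    (div_self (Plane.toComplex_sub_ne_zero (ne_of_mem_of_not_mem hz hp))).symm

theorem symm (h : LogEquivOn X p q) : LogEquivOn X q p :=
  (HasLogOn.inv h).congr fun _ _ => inv_div _ _

theorem trans (h : LogEquivOn X p q) (h' : LogEquivOn X q r) (hq : q ∉ X) :
    LogEquivOn X p r :=
  (HasLogOn.mul h h').congr fun _ hz =>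
    div_mul_div_cancel₀ (Plane.toComplex_sub_ne_zero (ne_of_mem_of_not_mem hz hq))

/-- On `X` the quotient is `1 + w` with `‖w‖ < 1`, so the principal logarithm applies. -/
theorem of_mem_ball {ε : ℝ} (hε : Metric.ball p ε ⊆ Xᶜ) (hq : q ∈ Metric.ball p ε) :
    LogEquivOn X q p := by
  have hp : p ∉ X := hε (Metric.mem_ball_self (dist_nonneg.trans_lt hq))
  have hne : ∀ z ∈ X, Plane.toComplex z - Plane.toComplex p ≠ 0 := fun z hz =>
    Plane.toComplex_sub_ne_zero (ne_of_mem_of_not_mem hz hp)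
  refine hasLogOn_of_slitPlane ?_ fun z hz => ?_
  · exact ContinuousOn.div (by fun_prop) (by fun_prop) hne
  · have hz' : (Plane.toComplex z - Plane.toComplex q) / (Plane.toComplex z - Plane.toComplex p) =
        1 + (Plane.toComplex p - Plane.toComplex q) /
          (Plane.toComplex z - Plane.toComplex p) := by
      field_simp [hne z hz]; ring
    rw [hz']
    apply Complex.mem_slitPlane_of_norm_lt_one
    rw [norm_div, Plane.norm_toComplex_sub, Plane.norm_toComplex_sub,
      div_lt_one (dist_pos.2 (ne_of_mem_of_not_mem hz hp)), dist_comm]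
    refine (Metric.mem_ball.1 hq).trans_le ?_
    by_contra hlt
    exact hε (Metric.mem_ball.2 (not_le.1 hlt)) hz

/-- Nearby points are equivalent, so both the class of `p` and its complement within `Xᶜ` are open;
a connected set cannot meet both. -/
theorem of_isPreconnected {S : Set Plane} (hX : IsClosed X) (hS : IsPreconnected S)
    (hSX : S ⊆ Xᶜ) (hp : p ∈ S) (hq : q ∈ S) : LogEquivOn X p q := by
  have hball : ∀ w ∉ X, ∃ ε > 0, Metric.ball w ε ⊆ Xᶜ := fun w hw =>
    Metric.isOpen_iff.1 hX.isOpen_compl w hw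
  have hU : IsOpen {w | w ∉ X ∧ LogEquivOn X p w} := by
    rw [Metric.isOpen_iff]
    rintro w ⟨hw, hpw⟩
    obtain ⟨ε, hε, hb⟩ := hball w hw
    exact ⟨ε, hε, fun v hv => ⟨hb hv, hpw.trans (of_mem_ball hb hv).symm hw⟩⟩
  have hW : IsOpen {w | w ∉ X ∧ ¬ LogEquivOn X p w} := by
    rw [Metric.isOpen_iff]
    rintro w ⟨hw, hpw⟩
    obtain ⟨ε, hε, hb⟩ := hball w hw
    exact ⟨ε, hε, fun v hv => ⟨hb hv, fun h => hpw (h.trans (of_mem_ball hb hv) (hb hv))⟩⟩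
  by_contra hpq
  obtain ⟨w, -, hw1, hw2⟩ := hS _ _ hU hW (fun w hw => by
    by_cases h : LogEquivOn X p w
    · exact Or.inl ⟨hSX hw, h⟩
    · exact Or.inr ⟨hSX hw, h⟩) ⟨p, hp, hSX hp, refl (hSX hp)⟩ ⟨q, hq, hSX hq, hpq⟩
  exact hw2.2 hw1.2

end LogEquivOn

/-- A bounded open set whose boundary lies in `X` separates its points from the others. -/
theorem not_logEquivOn_of_isBounded {X U : Set Plane} {p q : Plane} (hX : IsClosed X)
    (hUb : Bornology.IsBounded U) (hUX : frontier U ⊆ X) (hp : p ∈ U)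
    (hq : q ∉ U) (hqX : q ∉ X) : ¬ LogEquivOn X p q := by
  classical
  rintro ⟨f, hf, hfg⟩
  -- Tietze extends the logarithm from `X` to the plane. The function `g` below then replaces `z -
  -- p` inside `U` by a zero-free function with the same boundary values.
  obtain ⟨F, hF⟩ := ContinuousMap.exists_restrict_eq hX
    ⟨X.domRestrict f, continuousOn_iff_continuous_domRestrict.1 hf⟩
  have hF' : ∀ z ∈ X, F z = f z := fun z hz => congrArg (fun g => g ⟨z, hz⟩) hF
  let g : Plane → ℂ := U.piecewise
    (fun z => Complex.exp (F z) * (Plane.toComplex z - Plane.toComplex q))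
    (fun z => Plane.toComplex z - Plane.toComplex p)
  have hg : Continuous g := by
    refine Continuous.piecewise (fun z hz => ?_) (by fun_prop) (by fun_prop)
    have hzX := hUX hz
    rw [hF' z hzX, hfg z hzX, div_mul_cancel₀]
    exact Plane.toComplex_sub_ne_zero (fun h => hqX (h ▸ hzX))
  have hg0 : ∀ z, g z ≠ 0 := by
    intro z
    by_cases hz : z ∈ U
    · simp only [g, Set.piecewise_eq_of_mem _ _ _ hz]
      exact mul_ne_zero (Complex.exp_ne_zero _)
        (Plane.toComplex_sub_ne_zero (ne_of_mem_of_not_mem hz hq))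
    · simp only [g, Set.piecewise_eq_of_notMem _ _ _ hz]
      exact Plane.toComplex_sub_ne_zero (fun h => hz (h ▸ hp))
  obtain ⟨R, hR⟩ := hUb.subset_ball p
  have hRpos : 0 < R := by
    have := hR hp
    exact (dist_nonneg).trans_lt (Metric.mem_ball.1 this)
  -- Being zero-free on the whole plane, `g` has a logarithm; but on a sphere around `p` outside `U`
  -- it equals `z - p`.
  refine not_hasLogOn_sphere p hRpos (((hasLogOn_univ_plane hg hg0).mono
    (Set.subset_univ _)).congr fun z hz => ?_)
  have : z ∉ U := fun h => absurd (Metric.mem_ball.1 (hR h)) (by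
    rw [Metric.mem_sphere.1 hz]; exact lt_irrefl _)
  simp [g, this]

theorem isPreconnected_compl_closedBall (r : ℝ) :
    IsPreconnected (Metric.closedBall (0 : Plane) r)ᶜ := by
  rcases lt_or_ge r 0 with hr | hr
  · rw [Metric.closedBall_eq_empty.2 hr, Set.compl_empty]
    exact isPreconnected_univ
  have hS : IsPreconnected (Metric.sphere (0 : Plane) 1) :=
    isPreconnected_sphere (by
      rw [← Module.finrank_eq_rank, finrank_euclideanSpace_fin]; norm_num) 0 1
  have h := ((isPreconnected_Ioi (a := r)).prod hS).image
    (fun x : ℝ × Plane => x.1 • x.2) (by fun_prop)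
  convert h using 1
  ext z
  simp only [Set.mem_compl_iff, Metric.mem_closedBall, dist_zero_right, not_le, Set.mem_image,
    Set.mem_prod, Set.mem_Ioi, mem_sphere_iff_norm, sub_zero, Prod.exists]
  constructor
  · intro hz
    have hz0 : 0 < ‖z‖ := hr.trans_lt hz
    refine ⟨‖z‖, ‖z‖⁻¹ • z, ⟨hz, ?_⟩, ?_⟩
    · rw [norm_smul, norm_inv, norm_norm, inv_mul_cancel₀ hz0.ne']
    · rw [smul_smul, mul_inv_cancel₀ hz0.ne', one_smul]
  · rintro ⟨a, b, ⟨ha, hb⟩, rfl⟩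
    rw [norm_smul, hb, mul_one, Real.norm_of_nonneg (hr.trans ha.le)]
    exact ha

/-- The complement of a bounded set has at most one unbounded component. -/
theorem connectedComponentIn_eq_of_not_isBounded {X : Set Plane} {p q : Plane}
    (hX : Bornology.IsBounded X)
    (hp : ¬ Bornology.IsBounded (connectedComponentIn Xᶜ p))
    (hq : ¬ Bornology.IsBounded (connectedComponentIn Xᶜ q)) :
    connectedComponentIn Xᶜ p = connectedComponentIn Xᶜ q := by
  obtain ⟨R, hR⟩ := hX.subset_closedBall 0
  have key : ∀ x, ¬ Bornology.IsBounded (connectedComponentIn Xᶜ x) →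
      (Metric.closedBall (0 : Plane) R)ᶜ ⊆ connectedComponentIn Xᶜ x := by
    intro x hx
    have : ∃ y ∈ connectedComponentIn Xᶜ x, y ∈ (Metric.closedBall (0 : Plane) R)ᶜ := by
      by_contra! h
      exact hx (Metric.isBounded_closedBall.subset fun y hy => not_not.1 (h y hy))
    obtain ⟨y, hy, hyR⟩ := this
    rw [connectedComponentIn_eq hy]
    exact (isPreconnected_compl_closedBall R).subset_connectedComponentIn hyR
      (Set.compl_subset_compl.2 hR)
  have : ∃ y, y ∈ connectedComponentIn Xᶜ p ∧ y ∈ (Metric.closedBall (0 : Plane) R)ᶜ := by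
    by_contra! h
    exact hp (Metric.isBounded_closedBall.subset fun y hy => not_not.1 (h y hy))
  obtain ⟨y, hy, hyR⟩ := this
  rw [connectedComponentIn_eq hy, connectedComponentIn_eq (key q hq hyR)]

theorem IsClosed.frontier_connectedComponentIn_compl_subset {X : Set Plane} (hX : IsClosed X)
    (p : Plane) : frontier (connectedComponentIn Xᶜ p) ⊆ X := by
  intro z hz
  by_contra hzX
  have hopen := hX.isOpen_compl.connectedComponentIn (x := p)
  have hzo := hX.isOpen_compl.connectedComponentIn (x := z)
  rw [hopen.frontier_eq] at hz
  obtain ⟨w, hw, hw'⟩ := mem_closure_iff.1 hz.1 _ hzo (mem_connectedComponentIn hzX)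
  apply hz.2
  rw [connectedComponentIn_eq hw', ← connectedComponentIn_eq hw]
  exact mem_connectedComponentIn hzX

/-- Points that are equivalent in the sense of Eilenberg's criterion are not separated. -/
theorem LogEquivOn.mem_connectedComponentIn {X : Set Plane} {p q : Plane} (hX : IsCompact X)
    (hp : p ∉ X) (hq : q ∉ X) (h : LogEquivOn X p q) : q ∈ connectedComponentIn Xᶜ p := by
  by_contra hqp
  by_cases hbp : Bornology.IsBounded (connectedComponentIn Xᶜ p)
  · exact not_logEquivOn_of_isBounded hX.isClosed hbp
      (hX.isClosed.frontier_connectedComponentIn_compl_subset p)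
      (_root_.mem_connectedComponentIn hp) hqp hq h
  by_cases hbq : Bornology.IsBounded (connectedComponentIn Xᶜ q)
  · refine not_logEquivOn_of_isBounded hX.isClosed hbq
      (hX.isClosed.frontier_connectedComponentIn_compl_subset q)
      (_root_.mem_connectedComponentIn hq) (fun hpq => hqp ?_) hp h.symm
    rw [← connectedComponentIn_eq hpq]
    exact _root_.mem_connectedComponentIn hq
  · rw [connectedComponentIn_eq_of_not_isBounded hX.isBounded hbp hbq] at hqp
    exact hqp (_root_.mem_connectedComponentIn hq)

theorem isPreconnected_compl_of_logEquivOn {X : Set Plane} (hX : IsCompact X)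
    (h : ∀ p q, p ∉ X → q ∉ X → LogEquivOn X p q) : IsPreconnected Xᶜ := by
  rcases Xᶜ.eq_empty_or_nonempty with h0 | ⟨p, hp⟩
  · rw [h0]; exact isPreconnected_empty
  have : Xᶜ = connectedComponentIn Xᶜ p := subset_antisymm
    (fun q hq => (h p q hp hq).mem_connectedComponentIn hX hp hq) (connectedComponentIn_subset _ _)
  rw [this]
  exact isPreconnected_connectedComponentIn

theorem IsArc.logEquivOn {A : Set Plane} {x y p q : Plane} (hA : IsArc A x y) (hp : p ∉ A)
    (hq : q ∉ A) : LogEquivOn A p q := by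
  have hne : ∀ w ∉ A, ∀ z ∈ A, Plane.toComplex z - Plane.toComplex w ≠ 0 := fun w hw z hz =>
    Plane.toComplex_sub_ne_zero (fun h => hw (h ▸ hz))
  exact hA.hasLogOn (ContinuousOn.div (by fun_prop) (by fun_prop) (hne q hq))
    fun z hz => div_ne_zero (hne p hp z hz) (hne q hq z hz)

/-- Two closed sets that meet in at most two points `u`, `v`, and both join these points, together
separate the plane. -/
theorem not_isPreconnected_compl_union {A B : Set Plane} {u v : Plane} (hA : IsClosed A)
    (hB : IsClosed B) (huv : u ≠ v) (hAB : A ∩ B ⊆ {u, v})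
    (hlA : HasLogOn Aᶜ (fun z => (Plane.toComplex z - Plane.toComplex u) /
      (Plane.toComplex z - Plane.toComplex v)))
    (hlB : HasLogOn Bᶜ (fun z => (Plane.toComplex z - Plane.toComplex u) /
      (Plane.toComplex z - Plane.toComplex v))) : ¬ IsPreconnected (A ∪ B)ᶜ := by
  intro h
  rw [Set.compl_union] at h
  -- If the complement were connected, the logarithms would glue on the complement of `A ∩ B`, which
  -- contains a small circle around `u` but not `v`. There `z - v` has a logarithm, so `z - u` would
  -- have one too.
  have hlog := hlA.union_of_isOpen hlB hA.isOpen_compl hB.isOpen_compl h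
  have hd : 0 < dist u v := dist_pos.2 huv
  have hs : Metric.sphere u (dist u v / 2) ⊆ Aᶜ ∪ Bᶜ := by
    rw [← Set.compl_inter]
    intro z hz hz'
    have hz := Metric.mem_sphere.1 hz
    rcases hAB hz' with rfl | h
    · rw [dist_self] at hz; linarith
    · rw [Set.mem_singleton_iff.1 h, dist_comm] at hz
      linarith
  have hv : HasLogOn (Metric.sphere u (dist u v / 2)) (fun z =>
      Plane.toComplex z - Plane.toComplex v) := by
    have h1 : HasLogOn (Metric.sphere u (dist u v / 2)) (fun z =>
        (Plane.toComplex z - Plane.toComplex v) / (Plane.toComplex u - Plane.toComplex v)) := by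
      refine hasLogOn_of_slitPlane (by fun_prop) fun z hz => ?_
      have hne := Plane.toComplex_sub_ne_zero huv
      have : (Plane.toComplex z - Plane.toComplex v) / (Plane.toComplex u - Plane.toComplex v) =
          1 + (Plane.toComplex z - Plane.toComplex u) /
            (Plane.toComplex u - Plane.toComplex v) := by
        field_simp; ring
      rw [this]
      apply Complex.mem_slitPlane_of_norm_lt_one
      rw [norm_div, Plane.norm_toComplex_sub, Plane.norm_toComplex_sub, div_lt_one hd,
        Metric.mem_sphere.1 hz]
      linarith
    have h2 : HasLogOn (Metric.sphere u (dist u v / 2)) (fun _ =>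
        Plane.toComplex u - Plane.toComplex v) :=
      ⟨fun _ => Complex.log (Plane.toComplex u - Plane.toComplex v), continuousOn_const,
        fun _ _ => Complex.exp_log (Plane.toComplex_sub_ne_zero huv)⟩
    exact (h1.mul h2).congr fun z _ => div_mul_cancel₀ _ (Plane.toComplex_sub_ne_zero huv)
  refine not_hasLogOn_sphere u (half_pos hd) (((hlog.mono hs).mul hv).congr fun z hz => ?_)
  refine div_mul_cancel₀ _ (Plane.toComplex_sub_ne_zero fun h => ?_)
  rw [h, Metric.mem_sphere, dist_comm] at hz
  linarith

/-- A preconnected set that meets an open set but not its boundary lies in the open set. -/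
theorem IsPreconnected.subset_of_disjoint_frontier {Y : Type*} [TopologicalSpace Y] {S U : Set Y}
    (hS : IsPreconnected S) (hU : IsOpen U) (hd : Disjoint S (frontier U))
    (hne : (S ∩ U).Nonempty) : S ⊆ U := by
  refine hS.subset_left_of_subset_union hU isClosed_closure.isOpen_compl
    (Set.disjoint_compl_right_iff_subset.2 subset_closure) (fun z hz => ?_) hne
  by_contra h
  rw [Set.mem_union, not_or, Set.mem_compl_iff, not_not] at h
  refine Set.disjoint_left.1 hd hz ?_
  rw [hU.frontier_eq]
  exact ⟨h.2, h.1⟩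

/-! ### Arcs and the boundary of a face -/

theorem IsArc.isPreconnected {A : Set Plane} {x y : Plane} (hA : IsArc A x y) :
    IsPreconnected A := by
  obtain ⟨γ, hγ, hinj, h0, h1, rfl⟩ := hA
  exact isPreconnected_range hγ

theorem IsArc.isPreconnected_diff_left {A : Set Plane} {x y : Plane} (hA : IsArc A x y) :
    IsPreconnected (A \ {x}) := by
  obtain ⟨γ, hγ, hinj, rfl, h1, rfl⟩ := hA
  have : Set.range γ \ {γ 0} = γ '' Set.Ioi 0 := by
    ext z
    constructor
    · rintro ⟨⟨t, rfl⟩, ht⟩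
      exact ⟨t, unitInterval.pos_iff_ne_zero.2 fun h => ht (by rw [h]; rfl), rfl⟩
    · rintro ⟨t, ht, rfl⟩
      exact ⟨⟨t, rfl⟩, fun h => ht.ne' (hinj h)⟩
  rw [this]
  exact isPreconnected_Ioi.image _ hγ.continuousOn

theorem IsArc.exists_mem_ne {A : Set Plane} {x y : Plane} (hA : IsArc A x y) :
    ∃ z ∈ A, z ≠ x ∧ z ≠ y := by
  obtain ⟨γ, hγ, hinj, rfl, rfl, rfl⟩ := hA
  obtain ⟨t, ht0, ht1⟩ := exists_between (zero_lt_one (α := unitInterval))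
  exact ⟨γ t, ⟨t, rfl⟩, hinj.ne ht0.ne', hinj.ne ht1.ne⟩

theorem isArc_image_Iic {γ : unitInterval → Plane} (hγ : Continuous γ)
    (hinj : Function.Injective γ) {s : unitInterval} (hs : 0 < s) :
    IsArc (γ '' Set.Iic s) (γ 0) (γ s) := by
  refine ⟨fun t => γ (s * t), hγ.comp (continuous_const.mul continuous_id), fun t t' h => ?_,
    by simp, by simp, ?_⟩
  · have h := congrArg Subtype.val (hinj h)
    have hs' : (s : ℝ) ≠ 0 := fun h => hs.ne' (Subtype.ext h)
    simp only [Set.Icc.coe_mul] at h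
    exact Subtype.ext (mul_left_cancel₀ hs' h)
  · ext z
    constructor
    · rintro ⟨t, rfl⟩
      exact ⟨s * t, unitInterval.mul_le_left, rfl⟩
    · rintro ⟨r, hr, rfl⟩
      have hs' : (0 : ℝ) < s := hs
      have hr' : (r : ℝ) ≤ s := hr
      refine ⟨⟨r / s, div_nonneg r.2.1 hs'.le, (div_le_one hs').2 hr'⟩, ?_⟩
      refine congrArg γ (Subtype.ext ?_)
      simp only [Set.Icc.coe_mul]
      field_simp

/-- An initial piece of the reversed arc, which is why `γ 1` is listed as the first end. -/
theorem isArc_image_Ici {γ : unitInterval → Plane} (hγ : Continuous γ)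
    (hinj : Function.Injective γ) {s : unitInterval} (hs : s < 1) :
    IsArc (γ '' Set.Ici s) (γ 1) (γ s) := by
  have h := isArc_image_Iic (hγ.comp unitInterval.continuous_symm)
    (hinj.comp unitInterval.symm_bijective.injective) (s := unitInterval.symm s)
    (by rw [← unitInterval.symm_one]; exact unitInterval.strictAnti_symm hs)
  simp only [Function.comp_apply, unitInterval.symm_zero, unitInterval.symm_symm] at h
  convert h using 1
  rw [← Set.image_image γ unitInterval.symm]
  refine congrArg (γ '' ·) ?_
  ext r
  constructor
  · intro hr
    exact ⟨unitInterval.symm r, unitInterval.strictAnti_symm.antitone hr,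
      unitInterval.symm_symm r⟩
  · rintro ⟨t, ht, rfl⟩
    have := unitInterval.strictAnti_symm.antitone (Set.mem_Iic.1 ht)
    rwa [unitInterval.symm_symm] at this

/-- If an inner point of an arc of a plane set lies on the boundary of a face, the entire arc
does. -/
theorem IsArc.subset_frontier_connectedComponentIn {K A : Set Plane} {x y o p : Plane}
    (hA : IsArc A x y) (hK : IsCompact K) (hKA : K ∩ A ⊆ {x, y}) (ho : o ∈ (K ∪ A)ᶜ)
    (hpA : p ∈ A) (hpx : p ≠ x) (hpy : p ≠ y)
    (hp : p ∈ frontier (connectedComponentIn (K ∪ A)ᶜ o)) :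
    A ⊆ frontier (connectedComponentIn (K ∪ A)ᶜ o) := by
  have hcl : IsClosed (K ∪ A) := hK.isClosed.union hA.isCompact.isClosed
  obtain ⟨γ, hγ, hinj, rfl, rfl, rfl⟩ := hA
  set O := connectedComponentIn (K ∪ Set.range γ)ᶜ o with hO
  have hOo : IsOpen O := hcl.isOpen_compl.connectedComponentIn
  have hOK : O ⊆ (K ∪ Set.range γ)ᶜ := connectedComponentIn_subset _ _
  have hoO : o ∈ O := mem_connectedComponentIn ho
  have hfr : frontier O ⊆ K ∪ Set.range γ := hcl.frontier_connectedComponentIn_compl_subset o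
  obtain ⟨tp, rfl⟩ := hpA
  have hend : ∀ t, γ t ∈ K → t = 0 ∨ t = 1 := fun t ht => by
    rcases hKA ⟨ht, t, rfl⟩ with h | h
    · exact Or.inl (hinj h)
    · exact Or.inr (hinj h)
  have hIoo : γ '' Set.Ioo 0 1 ⊆ Kᶜ := by
    rintro _ ⟨t, ht, rfl⟩ h
    rcases hend t h with rfl | rfl
    · exact lt_irrefl _ ht.1
    · exact lt_irrefl _ ht.2
  have htp : tp ∈ Set.Ioo (0 : unitInterval) 1 :=
    ⟨unitInterval.pos_iff_ne_zero.2 fun h => hpx (by rw [h]),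
      unitInterval.lt_one_iff_ne_one.2 fun h => hpy (by rw [h])⟩
  -- The end points follow because the frontier is closed.
  suffices h : Set.Ioo (0 : unitInterval) 1 ⊆ γ ⁻¹' frontier O by
    have h' := closure_minimal h (isClosed_frontier.preimage hγ)
    rw [closure_Ioo zero_ne_one] at h'
    rintro _ ⟨t, rfl⟩
    exact h' ⟨t.2.1, t.2.2⟩
  intro t ht
  by_contra hq
  -- If `γ t` is off the frontier, so is a short subarc around it. With this subarc removed, `K` and
  -- the two remaining pieces still contain the frontier of `O`.
  have hnh : (γ ⁻¹' frontier O)ᶜ ∈ nhds t :=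
    (isClosed_frontier.preimage hγ).isOpen_compl.mem_nhds hq
  obtain ⟨s₁, ⟨hs₁, hs₁t⟩, h₁⟩ := exists_Ioc_subset_of_mem_nhds' hnh ht.1
  obtain ⟨s₂, ⟨hts₂, hs₂⟩, h₂⟩ := exists_Ico_subset_of_mem_nhds' hnh ht.2
  obtain ⟨r₁, hr₁, hr₁t⟩ := exists_between hs₁t
  obtain ⟨r₂, hr₂t, hr₂⟩ := exists_between hts₂
  have hA₁ := isArc_image_Iic hγ hinj (hs₁.trans_lt hr₁)
  have hA₂ := isArc_image_Ici hγ hinj (hr₂.trans_le hs₂)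
  have hsub₁ : γ '' Set.Iic r₁ ⊆ Set.range γ := Set.image_subset_range _ _
  have hsub₂ : γ '' Set.Ici r₂ ⊆ Set.range γ := Set.image_subset_range _ _
  have hfr' : frontier O ⊆ (K ∪ γ '' Set.Iic r₁) ∪ γ '' Set.Ici r₂ := by
    intro z hz
    rcases hfr hz with h | ⟨s, rfl⟩
    · exact Or.inl (Or.inl h)
    · rcases le_or_gt s r₁ with h | h
      · exact Or.inl (Or.inr ⟨s, h, rfl⟩)
      rcases le_or_gt r₂ s with h' | h'
      · exact Or.inr ⟨s, h', rfl⟩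
      exfalso
      rcases le_total s t with hst | hst
      · exact h₁ ⟨hr₁.trans h, hst⟩ hz
      · exact h₂ ⟨hst, h'.trans hr₂⟩ hz
  have hqK : γ t ∉ K := hIoo ⟨t, ht, rfl⟩
  have hq₁ : γ t ∉ γ '' Set.Iic r₁ := by
    rintro ⟨s, hs, hst⟩
    exact (hr₁t.trans_le (hinj hst ▸ hs)).false
  have hq₂ : γ t ∉ γ '' Set.Ici r₂ := by
    rintro ⟨s, hs, hst⟩
    exact (hr₂t.trans_le' (hinj hst ▸ hs)).false
  have hoA : o ∉ Set.range γ := fun h => ho (Or.inr h)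
  have hoK : o ∉ K := fun h => ho (Or.inl h)
  have hpK : γ tp ∉ K := hIoo ⟨tp, htp, rfl⟩
  -- With respect to `K` alone, `o` reaches `γ tp` through the closure of `O`, and then `γ t` along
  -- the inner part of the arc.
  have hlogK : LogEquivOn K o (γ t) := by
    have hOp : LogEquivOn K o (γ tp) := by
      refine LogEquivOn.of_isPreconnected hK.isClosed (S := insert (γ tp) O) ?_ ?_
        (Set.mem_insert_of_mem _ hoO) (Set.mem_insert _ _)
      · exact isPreconnected_connectedComponentIn.subset_closure (Set.subset_insert _ _)
          (Set.insert_subset (frontier_subset_closure hp) subset_closure)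
      · exact Set.insert_subset hpK fun z hz hzK => hOK hz (Or.inl hzK)
    exact hOp.trans (LogEquivOn.of_isPreconnected hK.isClosed
      (isPreconnected_Ioo.image _ hγ.continuousOn) hIoo ⟨tp, htp, rfl⟩ ⟨t, ht, rfl⟩) hpK
  -- Each end piece meets what is already present in at most one point, so adding it preserves the
  -- equivalence.
  have hlog₁ : LogEquivOn (K ∪ γ '' Set.Iic r₁) o (γ t) := by
    refine HasLogOn.union_of_isClosed hlogK (hA₁.logEquivOn (fun h => hoA (hsub₁ h)) hq₁)
      hK.isClosed hA₁.isCompact.isClosed (Set.Subsingleton.isPreconnected ?_)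
    have : K ∩ γ '' Set.Iic r₁ ⊆ {γ 0} := by
      rintro _ ⟨hzK, s, hs, rfl⟩
      rcases hend s hzK with rfl | rfl
      · rfl
      · exact absurd (ht.2.trans_le (hs.trans hr₁t.le)) (lt_irrefl _)
    exact Set.subsingleton_singleton.anti this
  have hlog₂ : LogEquivOn ((K ∪ γ '' Set.Iic r₁) ∪ γ '' Set.Ici r₂) o (γ t) := by
    refine HasLogOn.union_of_isClosed hlog₁ (hA₂.logEquivOn (fun h => hoA (hsub₂ h)) hq₂)
      (hK.isClosed.union hA₁.isCompact.isClosed) hA₂.isCompact.isClosed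
      (Set.Subsingleton.isPreconnected ?_)
    have : (K ∪ γ '' Set.Iic r₁) ∩ γ '' Set.Ici r₂ ⊆ {γ 1} := by
      rintro _ ⟨hzK | ⟨s', hs', hss⟩, s, hs, rfl⟩
      · rcases hend s hzK with rfl | rfl
        · exact absurd (ht.1.trans (hr₂t.trans_le hs)) (lt_irrefl _)
        · rfl
      · rw [hinj hss] at hs'
        exact absurd (hr₁t.trans (hr₂t.trans_le (hs.trans hs'))) (lt_irrefl _)
    exact Set.subsingleton_singleton.anti this
  have hmem := hlog₂.mem_connectedComponentIn
    ((hK.union hA₁.isCompact).union hA₂.isCompact)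
    (by rintro ((h | h) | h); exacts [hoK h, hoA (hsub₁ h), hoA (hsub₂ h)])
    (by rintro ((h | h) | h); exacts [hqK h, hq₁ h, hq₂ h])
  -- The component of `o` in the enlarged complement avoids the frontier of `O`, so it stays in `O`;
  -- yet it contains `γ t`, a point of the arc.
  have hsubO := (isPreconnected_connectedComponentIn
    (F := ((K ∪ γ '' Set.Iic r₁) ∪ γ '' Set.Ici r₂)ᶜ) (x := o)).subset_of_disjoint_frontier hOo
    (Set.disjoint_left.2 fun z hz hz' => connectedComponentIn_subset _ _ hz (hfr' hz'))
    ⟨o, mem_connectedComponentIn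
      (by rintro ((h | h) | h); exacts [hoK h, hoA (hsub₁ h), hoA (hsub₂ h)]), hoO⟩
  exact hOK (hsubO hmem) (Or.inr ⟨t, rfl⟩)

/-! ### Faces, walks and crossings in a plane graph -/

namespace PlaneGraph

variable {V : Type*}

theorem exists_arc_isArc (G : PlaneGraph V) {e : Sym2 V} (he : e ∈ G.graph.edgeSet) :
    ∃ u v, e = s(u, v) ∧ IsArc (G.arc e) (G.pos u) (G.pos v) := by
  induction e with
  | h u v => exact ⟨u, v, rfl, G.arc_isArc u v he⟩

theorem exists_eq_pos_of_mem_arc (G : PlaneGraph V) {e f : Sym2 V} (he : e ∈ G.graph.edgeSet)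
    (hf : f ∈ G.graph.edgeSet) (hef : e ≠ f) {z : Plane} (hz : z ∈ G.arc e) (hz' : z ∈ G.arc f) :
    ∃ w, z = G.pos w ∧ w ∈ e ∧ w ∈ f := by
  obtain ⟨w, rfl⟩ := G.arc_inter_subset e he f hf hef ⟨hz, hz'⟩
  exact ⟨w, rfl, G.mem_of_pos_mem_arc e he w hz, G.mem_of_pos_mem_arc f hf w hz'⟩

theorem exists_mem_arc_notMem_range (G : PlaneGraph V) {e : Sym2 V}
    (he : e ∈ G.graph.edgeSet) : ∃ z ∈ G.arc e, z ∉ Set.range G.pos := by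
  obtain ⟨u, v, rfl, h⟩ := G.exists_arc_isArc he
  obtain ⟨z, hz, hu, hv⟩ := h.exists_mem_ne
  refine ⟨z, hz, ?_⟩
  rintro ⟨w, rfl⟩
  rcases Sym2.mem_iff.1 (G.mem_of_pos_mem_arc _ he w hz) with rfl | rfl
  · exact hu rfl
  · exact hv rfl

theorem arc_subset_carrier (G : PlaneGraph V) {e : Sym2 V} (he : e ∈ G.graph.edgeSet) :
    G.arc e ⊆ G.carrier :=
  fun _ hz => Or.inr (Set.mem_biUnion he hz)

theorem isCompact_carrier [Finite V] (G : PlaneGraph V) : IsCompact G.carrier := by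
  refine (Set.finite_range G.pos).isCompact.union
    ((Set.toFinite G.graph.edgeSet).isCompact_biUnion fun e he => ?_)
  obtain ⟨u, v, -, h⟩ := G.exists_arc_isArc he
  exact h.isCompact

/-- There is exactly one unbounded face. -/
theorem exists_outerFace_eq [Finite V] (G : PlaneGraph V) :
    ∃ o ∈ G.carrierᶜ, G.outerFace = connectedComponentIn G.carrierᶜ o ∧
      ¬ Bornology.IsBounded (connectedComponentIn G.carrierᶜ o) := by
  obtain ⟨R, hR⟩ := G.isCompact_carrier.isBounded.subset_closedBall 0
  have hub : ¬ Bornology.IsBounded (Metric.closedBall (0 : Plane) R)ᶜ := fun h =>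
    NormedSpace.unbounded_univ ℝ Plane (by
      rw [← Set.union_compl_self (Metric.closedBall (0 : Plane) R)]
      exact Metric.isBounded_closedBall.union h)
  obtain ⟨o, ho⟩ : (Metric.closedBall (0 : Plane) R)ᶜ.Nonempty := by
    rw [Set.nonempty_iff_ne_empty]
    exact fun h => hub (h ▸ Bornology.isBounded_empty)
  have hob : ¬ Bornology.IsBounded (connectedComponentIn G.carrierᶜ o) := fun h => hub (h.subset
    ((isPreconnected_compl_closedBall R).subset_connectedComponentIn ho
      (Set.compl_subset_compl.2 hR)))
  have hoc : o ∈ G.carrierᶜ := fun h => ho (hR h)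
  refine ⟨o, hoc, Set.ext fun x => ⟨fun hx => ?_, fun hx => ⟨?_, ?_⟩⟩, hob⟩
  · rw [connectedComponentIn_eq_of_not_isBounded G.isCompact_carrier.isBounded hob hx.2]
    exact mem_connectedComponentIn hx.1
  · exact connectedComponentIn_subset _ _ hx
  · rwa [← connectedComponentIn_eq hx]

theorem isOpen_outerFace [Finite V] (G : PlaneGraph V) : IsOpen G.outerFace := by
  obtain ⟨o, -, h, -⟩ := G.exists_outerFace_eq
  rw [h]
  exact G.isCompact_carrier.isClosed.isOpen_compl.connectedComponentIn

theorem isPreconnected_outerFace [Finite V] (G : PlaneGraph V) : IsPreconnected G.outerFace := by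
  obtain ⟨o, -, h, -⟩ := G.exists_outerFace_eq
  rw [h]
  exact isPreconnected_connectedComponentIn

theorem outerFace_nonempty [Finite V] (G : PlaneGraph V) : G.outerFace.Nonempty := by
  obtain ⟨o, ho, h, -⟩ := G.exists_outerFace_eq
  rw [h]
  exact ⟨o, mem_connectedComponentIn ho⟩

theorem frontier_outerFace_subset [Finite V] (G : PlaneGraph V) :
    frontier G.outerFace ⊆ G.carrier := by
  obtain ⟨o, -, h, -⟩ := G.exists_outerFace_eq
  rw [h]
  exact G.isCompact_carrier.isClosed.frontier_connectedComponentIn_compl_subset o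

theorem carrier_deleteEdges_union (G : PlaneGraph V) {e : Sym2 V} (he : e ∈ G.graph.edgeSet) :
    (G.deleteEdges {e}).carrier ∪ G.arc e = G.carrier := by
  ext z
  simp only [carrier, deleteEdges, SimpleGraph.edgeSet_deleteEdges, Set.mem_union,
    Set.mem_iUnion, Set.mem_sdiff, Set.mem_singleton_iff, exists_prop]
  constructor
  · rintro ((h | ⟨f, hf, hz⟩) | h)
    exacts [Or.inl h, Or.inr ⟨f, hf.1, hz⟩, Or.inr ⟨e, he, h⟩]
  · rintro (h | ⟨f, hf, hz⟩)
    · exact Or.inl (Or.inl h)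
    · by_cases hfe : f = e
      · exact Or.inr (hfe ▸ hz)
      · exact Or.inl (Or.inr ⟨f, ⟨hf, hfe⟩, hz⟩)

theorem exists_eq_pos_of_mem_carrier_deleteEdges (G : PlaneGraph V) {e : Sym2 V}
    (he : e ∈ G.graph.edgeSet) {z : Plane} (hz : z ∈ (G.deleteEdges {e}).carrier)
    (hze : z ∈ G.arc e) : ∃ w ∈ e, z = G.pos w := by
  rcases hz with ⟨w, rfl⟩ | hz
  · exact ⟨w, G.mem_of_pos_mem_arc e he w hze, rfl⟩
  · obtain ⟨f, hf, hzf⟩ := Set.mem_iUnion₂.1 hz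
    rw [deleteEdges, SimpleGraph.edgeSet_deleteEdges] at hf
    obtain ⟨w, rfl, hw, -⟩ := G.exists_eq_pos_of_mem_arc he hf.1 (fun h => hf.2 h.symm) hze hzf
    exact ⟨w, hw, rfl⟩

/-- An edge with an inner point on the boundary of the outer face lies on this boundary. -/
theorem isOuterEdge_of_mem_frontier [Finite V] (G : PlaneGraph V) {e : Sym2 V}
    (he : e ∈ G.graph.edgeSet) {z : Plane} (hz : z ∈ G.arc e) (hzp : z ∉ Set.range G.pos)
    (hzf : z ∈ frontier G.outerFace) : G.IsOuterEdge e := by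
  refine ⟨he, ?_⟩
  obtain ⟨u, v, rfl, harc⟩ := G.exists_arc_isArc he
  obtain ⟨o, ho, h, -⟩ := G.exists_outerFace_eq
  rw [h] at hzf ⊢
  rw [← G.carrier_deleteEdges_union he] at ho hzf ⊢
  refine harc.subset_frontier_connectedComponentIn (G.deleteEdges _).isCompact_carrier
    (fun y hy => ?_) ho hz (fun h => hzp ⟨u, h.symm⟩) (fun h => hzp ⟨v, h.symm⟩) hzf
  obtain ⟨w, hw, rfl⟩ := G.exists_eq_pos_of_mem_carrier_deleteEdges he hy.1 hy.2
  rcases Sym2.mem_iff.1 hw with rfl | rfl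
  · exact Or.inl rfl
  · exact Or.inr rfl

/-- The point set of a walk. -/
def walkCarrier (G : PlaneGraph V) {u v : V} (p : G.graph.Walk u v) : Set Plane :=
  {G.pos u} ∪ ⋃ e ∈ {e | e ∈ p.edges}, G.arc e

section Walk

variable (G : PlaneGraph V) {u v w : V}

theorem walkCarrier_nil : G.walkCarrier (.nil : G.graph.Walk u u) = {G.pos u} := by
  simp [walkCarrier]

theorem walkCarrier_cons (h : G.graph.Adj u v) (p : G.graph.Walk v w) :
    G.walkCarrier (.cons h p) = G.arc s(u, v) ∪ G.walkCarrier p := by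
  have hu := (G.arc_isArc u v h).left_mem
  have hv := (G.arc_isArc u v h).right_mem
  ext z
  simp only [walkCarrier, SimpleGraph.Walk.edges_cons, List.mem_cons, Set.mem_union,
    Set.mem_singleton_iff, Set.mem_iUnion, Set.mem_ofPred_eq, exists_prop, exists_eq_or_imp]
  constructor
  · rintro (rfl | h | h)
    exacts [Or.inl hu, Or.inl h, Or.inr (Or.inr h)]
  · rintro (h | rfl | h)
    exacts [Or.inr (Or.inl h), Or.inr (Or.inl hv), Or.inr (Or.inr h)]

theorem isCompact_walkCarrier (p : G.graph.Walk u v) : IsCompact (G.walkCarrier p) := by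
  induction p with
  | nil => rw [walkCarrier_nil]; exact isCompact_singleton
  | cons h p ih => rw [walkCarrier_cons]; exact (G.arc_isArc _ _ h).isCompact.union ih

variable {G} in
theorem arc_subset_walkCarrier {p : G.graph.Walk u v} {e : Sym2 V} (he : e ∈ p.edges) :
    G.arc e ⊆ G.walkCarrier p :=
  fun _ hz => Or.inr (Set.mem_biUnion (s := {e | e ∈ p.edges}) he hz)

variable {G} in
theorem pos_mem_walkCarrier {p : G.graph.Walk u v} (hw : w ∈ p.support) :
    G.pos w ∈ G.walkCarrier p := by
  induction p with
  | nil =>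
    rw [SimpleGraph.Walk.support_nil, List.mem_singleton] at hw
    rw [walkCarrier_nil, hw]; rfl
  | cons h p ih =>
    rw [walkCarrier_cons]
    rw [SimpleGraph.Walk.support_cons, List.mem_cons] at hw
    rcases hw with rfl | hw
    · exact Or.inl (G.arc_isArc _ _ h).left_mem
    · exact Or.inr (ih hw)

variable {G} in
theorem mem_walkCarrier {p : G.graph.Walk u v} {z : Plane} (hz : z ∈ G.walkCarrier p) :
    (∃ w ∈ p.support, z = G.pos w) ∨ ∃ e ∈ p.edges, z ∈ G.arc e := by
  rcases hz with h | h
  · exact Or.inl ⟨u, p.start_mem_support, h⟩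
  · obtain ⟨e, he, hz⟩ := Set.mem_iUnion₂.1 h
    exact Or.inr ⟨e, he, hz⟩

theorem walkCarrier_subset_carrier (p : G.graph.Walk u v) : G.walkCarrier p ⊆ G.carrier := by
  intro z hz
  rcases mem_walkCarrier hz with ⟨w, -, rfl⟩ | ⟨e, he, hz⟩
  · exact Or.inl ⟨w, rfl⟩
  · exact G.arc_subset_carrier (p.edges_subset_edgeSet he) hz

variable {G} in
/-- A walk meets the arc of an edge that it does not use in vertices only. -/
theorem exists_eq_pos_of_mem_walkCarrier {p : G.graph.Walk u v} {e : Sym2 V}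
    (he : e ∈ G.graph.edgeSet) (hep : e ∉ p.edges) {z : Plane} (hz : z ∈ G.walkCarrier p)
    (hze : z ∈ G.arc e) : ∃ w ∈ p.support, w ∈ e ∧ z = G.pos w := by
  rcases mem_walkCarrier hz with ⟨w, hw, rfl⟩ | ⟨f, hf, hz⟩
  · exact ⟨w, hw, G.mem_of_pos_mem_arc e he w hze, rfl⟩
  · obtain ⟨w, rfl, hwe, hwf⟩ := G.exists_eq_pos_of_mem_arc he (p.edges_subset_edgeSet hf)
      (fun h => hep (h ▸ hf)) hze hz
    exact ⟨w, p.mem_support_of_mem_edges hf hwf, hwe, rfl⟩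

variable {G} in
/-- A path does not separate the plane. -/
theorem logEquivOn_walkCarrier {p : G.graph.Walk u v} (hp : p.IsPath) {x y : Plane}
    (hx : x ∉ G.walkCarrier p) (hy : y ∉ G.walkCarrier p) :
    LogEquivOn (G.walkCarrier p) x y := by
  induction p with
  | @nil a =>
    rw [walkCarrier_nil] at *
    refine ⟨fun _ => Complex.log ((Plane.toComplex (G.pos a) - Plane.toComplex x) /
      (Plane.toComplex (G.pos a) - Plane.toComplex y)), continuousOn_const, ?_⟩
    rintro z rfl
    exact Complex.exp_log (div_ne_zero (Plane.toComplex_sub_ne_zero fun h => hx h.symm)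
      (Plane.toComplex_sub_ne_zero fun h => hy h.symm))
  | @cons a b c h p ih =>
    rw [walkCarrier_cons, Set.mem_union, not_or] at hx hy
    rw [SimpleGraph.Walk.cons_isPath_iff] at hp
    rw [walkCarrier_cons]
    refine HasLogOn.union_of_isClosed ((G.arc_isArc _ _ h).logEquivOn hx.1 hy.1)
      (ih hp.1 hx.2 hy.2) (G.arc_isArc _ _ h).isCompact.isClosed
      (G.isCompact_walkCarrier p).isClosed (Set.Subsingleton.isPreconnected ?_)
    -- In a path the first arc meets the rest only in `b`, so the gluing needs connectedness of at
    -- most a point.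
    refine Set.subsingleton_singleton.anti (t := {G.pos b}) fun z hz => ?_
    obtain ⟨w, hw, hwe, rfl⟩ := exists_eq_pos_of_mem_walkCarrier (e := s(a, b)) h
      (fun he => hp.2 (p.fst_mem_support_of_mem_edges he)) hz.2 hz.1
    rcases Sym2.mem_iff.1 hwe with rfl | rfl
    · exact absurd hw hp.2
    · rfl

variable {G} in
theorem isPreconnected_compl_walkCarrier {p : G.graph.Walk u v} (hp : p.IsPath) :
    IsPreconnected (G.walkCarrier p)ᶜ :=
  isPreconnected_compl_of_logEquivOn (G.isCompact_walkCarrier p)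
    fun _ _ => logEquivOn_walkCarrier hp

/-- The quotients for successive edges telescope, so the walk need not be a path. -/
theorem hasLogOn_compl_walkCarrier (p : G.graph.Walk u v) :
    HasLogOn (G.walkCarrier p)ᶜ (fun z => (Plane.toComplex z - Plane.toComplex (G.pos u)) /
      (Plane.toComplex z - Plane.toComplex (G.pos v))) := by
  induction p with
  | nil =>
    rw [walkCarrier_nil]
    exact hasLogOn_one.congr fun z hz => (div_self (Plane.toComplex_sub_ne_zero hz)).symm
  | @cons a b c h p ih =>
    rw [walkCarrier_cons]
    refine (((G.arc_isArc _ _ h).hasLogOn_compl.mono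
      (Set.compl_subset_compl.2 Set.subset_union_left)).mul
      (ih.mono (Set.compl_subset_compl.2 Set.subset_union_right))).congr fun z hz => ?_
    refine div_mul_div_cancel₀ (Plane.toComplex_sub_ne_zero ?_)
    rintro rfl
    exact hz (Or.inl (G.arc_isArc _ _ h).right_mem)

end Walk

/-- If the ends of an edge on the outer boundary are still joined by a path after the deletion of
the edge, then the deletion merges a bounded face into the outer face. -/
theorem exists_isBoundedFace_subset [Finite V] (G : PlaneGraph V) {u v : V}
    (he : G.IsOuterEdge s(u, v)) {p : (G.deleteEdges {s(u, v)}).graph.Walk u v} (hp : p.IsPath) :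
    ∃ F, G.IsBoundedFace F ∧ F ⊆ (G.deleteEdges {s(u, v)}).outerFace := by
  have harc := G.arc_isArc u v he.1
  set K := (G.deleteEdges {s(u, v)}).carrier with hK
  set P := (G.deleteEdges {s(u, v)}).walkCarrier p with hP
  have hPc : IsCompact P := (G.deleteEdges {s(u, v)}).isCompact_walkCarrier p
  have hPK : P ⊆ K := (G.deleteEdges {s(u, v)}).walkCarrier_subset_carrier p
  have hKG : K ∪ G.arc s(u, v) = G.carrier := G.carrier_deleteEdges_union he.1
  have hKe : K ∩ G.arc s(u, v) ⊆ {G.pos u, G.pos v} := by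
    intro z hz
    obtain ⟨w, hw, rfl⟩ := G.exists_eq_pos_of_mem_carrier_deleteEdges he.1 hz.1 hz.2
    rcases Sym2.mem_iff.1 hw with rfl | rfl
    · exact Or.inl rfl
    · exact Or.inr rfl
  have huP : G.pos u ∈ P := pos_mem_walkCarrier (G := G.deleteEdges {s(u, v)}) p.start_mem_support
  have hvP : G.pos v ∈ P := pos_mem_walkCarrier (G := G.deleteEdges {s(u, v)}) p.end_mem_support
  set J := G.arc s(u, v) ∪ P with hJ
  have hJc : IsCompact J := harc.isCompact.union hPc
  have hJG : J ⊆ G.carrier := by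
    rw [← hKG, Set.union_comm]
    exact Set.union_subset_union_right _ hPK
  -- The closed curve formed by the edge and `p` separates the plane. At most one component of its
  -- complement is unbounded, so some component `X` is bounded.
  have hJsep : ¬ IsPreconnected Jᶜ :=
    not_isPreconnected_compl_union harc.isCompact.isClosed hPc.isClosed
      (G.pos_injective.ne he.1.ne) (fun z hz => hKe ⟨hPK hz.2, hz.1⟩) harc.hasLogOn_compl
      ((G.deleteEdges {s(u, v)}).hasLogOn_compl_walkCarrier p)
  obtain ⟨x, hxJ, hxb⟩ : ∃ x ∈ Jᶜ, Bornology.IsBounded (connectedComponentIn Jᶜ x) := by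
    by_contra! h
    refine hJsep (isPreconnected_of_forall_pair fun x hx y hy =>
      ⟨connectedComponentIn Jᶜ x, connectedComponentIn_subset _ _, mem_connectedComponentIn hx, ?_,
        isPreconnected_connectedComponentIn⟩)
    rw [connectedComponentIn_eq_of_not_isBounded hJc.isBounded (h x hx) (h y hy)]
    exact mem_connectedComponentIn hy
  set X := connectedComponentIn Jᶜ x with hX
  have hXo : IsOpen X := hJc.isClosed.isOpen_compl.connectedComponentIn
  have hXJ : frontier X ⊆ J := hJc.isClosed.frontier_connectedComponentIn_compl_subset x
  -- Otherwise `X` would swallow the connected complement of the path and be unbounded.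
  obtain ⟨z, hzX, hzP⟩ : ∃ z ∈ frontier X, z ∉ P := by
    by_contra! h
    have hsub := (isPreconnected_compl_walkCarrier
      (G := G.deleteEdges {s(u, v)}) hp).subset_of_disjoint_frontier hXo
      (Set.disjoint_left.2 fun z hz hz' => hz (h z hz'))
      ⟨x, fun hx => hxJ (Or.inr hx), mem_connectedComponentIn hxJ⟩
    refine NormedSpace.unbounded_univ ℝ Plane ?_
    rw [← Set.union_compl_self P]
    exact hPc.isBounded.union (hxb.subset hsub)
  have hze : z ∈ G.arc s(u, v) := (hXJ hzX).resolve_right hzP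
  have hzK : z ∉ K := by
    intro h
    rcases hKe ⟨h, hze⟩ with h' | h'
    · exact hzP (h' ▸ huP)
    · exact hzP (h' ▸ hvP)
  have hKo : IsOpen Kᶜ := (G.deleteEdges {s(u, v)}).isCompact_carrier.isClosed.isOpen_compl
  have hF₀ : connectedComponentIn Kᶜ z ∈ nhds z :=
    hKo.connectedComponentIn.mem_nhds (mem_connectedComponentIn hzK)
  -- Since `z` lies on the deleted outer edge, its face after the deletion contains the old outer
  -- face.
  have hOF₀ : G.outerFace ⊆ connectedComponentIn Kᶜ z := by
    obtain ⟨y, hyz, hyO⟩ := mem_closure_iff_nhds.1 (frontier_subset_closure (he.2 hze)) _ hF₀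
    rw [connectedComponentIn_eq hyz]
    exact G.isPreconnected_outerFace.subset_connectedComponentIn hyO
      fun w hw hwK => hw.1 (hKG ▸ Or.inl hwK)
  have hub : ¬ Bornology.IsBounded (connectedComponentIn Kᶜ z) := by
    obtain ⟨o, -, hO, hob⟩ := G.exists_outerFace_eq
    exact fun h => hob (hO ▸ h.subset hOF₀)
  -- The same new face meets `X` near `z`; the old face of such a point `y` lies in `X`, so it is
  -- the bounded face sought.
  obtain ⟨y, hyz, hyX⟩ := mem_closure_iff_nhds.1 (frontier_subset_closure hzX) _ hF₀
  have hyJ : y ∉ J := connectedComponentIn_subset _ _ hyX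
  have hyG : y ∈ G.carrierᶜ := by
    rw [← hKG]
    rintro (h | h)
    · exact connectedComponentIn_subset _ _ hyz h
    · exact hyJ (Or.inl h)
  refine ⟨connectedComponentIn G.carrierᶜ y, ⟨⟨y, hyG, rfl⟩, hxb.subset ?_⟩, fun w hw => ?_⟩
  · rw [hX, connectedComponentIn_eq hyX]
    exact connectedComponentIn_mono _ (Set.compl_subset_compl.2 hJG)
  · have hw' : w ∈ connectedComponentIn Kᶜ z := by
      rw [connectedComponentIn_eq hyz]
      refine connectedComponentIn_mono _ (Set.compl_subset_compl.2 ?_) hw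
      rw [← hKG]
      exact Set.subset_union_left
    refine ⟨connectedComponentIn_subset _ _ hw', ?_⟩
    rwa [← connectedComponentIn_eq hw']

theorem mem_frontier_outerFace [Finite V] (G : PlaneGraph V) {z : Plane}
    (hz : z ∈ frontier G.outerFace) :
    (∃ w, z = G.pos w) ∨ ∃ e, G.IsOuterEdge e ∧ z ∈ G.arc e := by
  by_cases hzp : z ∈ Set.range G.pos
  · exact Or.inl (hzp.imp fun _ h => h.symm)
  · rcases G.frontier_outerFace_subset hz with h | h
    · exact absurd h hzp
    · obtain ⟨e, he, hze⟩ := Set.mem_iUnion₂.1 h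
      exact Or.inr ⟨e, G.isOuterEdge_of_mem_frontier he hze hzp hz, hze⟩

/-- If all edges on the outer boundary belong to the cycle formed by a spanning path `p` and an
edge `e`, then `e` lies on the outer boundary. -/
theorem isOuterEdge_of_isPath [Finite V] (G : PlaneGraph V) {u v : V} {p : G.graph.Walk u v}
    (hp : p.IsPath) (hs : ∀ w, w ∈ p.support) {e : Sym2 V} (he : e ∈ G.graph.edgeSet)
    (hep : e ∉ p.edges) (hout : ∀ f, G.IsOuterEdge f → f = e ∨ f ∈ p.edges) :
    G.IsOuterEdge e := by
  by_contra hne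
  have hfr : frontier G.outerFace ⊆ G.walkCarrier p := by
    intro z hz
    rcases G.mem_frontier_outerFace hz with ⟨w, rfl⟩ | ⟨f, hf, hzf⟩
    · exact pos_mem_walkCarrier (hs w)
    · rcases hout f hf with rfl | h
      · exact absurd hf hne
      · exact arc_subset_walkCarrier h hzf
  obtain ⟨o, ho⟩ := G.outerFace_nonempty
  -- The complement of a path is connected, so an outer boundary inside the path would force the
  -- outer face to contain the inner points of `e`.
  have hsub := (isPreconnected_compl_walkCarrier hp).subset_of_disjoint_frontier
    G.isOpen_outerFace (Set.disjoint_left.2 fun z hz hz' => hz (hfr hz'))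
    ⟨o, fun h => ho.1 (G.walkCarrier_subset_carrier p h), ho⟩
  obtain ⟨z, hz, hzp⟩ := G.exists_mem_arc_notMem_range he
  refine (hsub (a := z) fun h => hzp ?_).1 (G.arc_subset_carrier he hz)
  obtain ⟨w, -, -, rfl⟩ := exists_eq_pos_of_mem_walkCarrier he hep h hz
  exact ⟨w, rfl⟩

/-- An edge that leaves the cycle `p + e` to an exterior vertex runs in the same face of this
cycle as the outer face. -/
theorem logEquivOn_arc_union_walkCarrier [Finite V] (G : PlaneGraph V) {u v a b : V}
    {p : G.graph.Walk u v} (he : G.graph.Adj u v) (hf : G.graph.Adj a b)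
    (hb : b ∉ p.support) (hbx : G.IsExterior b) {z o : Plane} (hz : z ∈ G.arc s(a, b))
    (hzp : z ∉ Set.range G.pos) (ho : o ∈ G.outerFace) :
    LogEquivOn (G.arc s(u, v) ∪ G.walkCarrier p) z o := by
  have hJ : IsClosed (G.arc s(u, v) ∪ G.walkCarrier p) :=
    (G.arc_isArc u v he).isCompact.isClosed.union (G.isCompact_walkCarrier p).isClosed
  have hJG : G.arc s(u, v) ∪ G.walkCarrier p ⊆ G.carrier :=
    Set.union_subset (G.arc_subset_carrier he) (G.walkCarrier_subset_carrier p)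
  have huv : ∀ w ∈ s(u, v), w ∈ p.support := by
    intro w hw
    rcases Sym2.mem_iff.1 hw with rfl | rfl
    · exact p.start_mem_support
    · exact p.end_mem_support
  have hfe : s(a, b) ≠ s(u, v) := fun h => hb (huv b (h ▸ Sym2.mem_mk_right a b))
  have hfp : s(a, b) ∉ p.edges := fun h => hb (p.snd_mem_support_of_mem_edges h)
  have hinter : ∀ y ∈ G.arc s(a, b), y ∈ G.arc s(u, v) ∪ G.walkCarrier p → y = G.pos a := by
    intro y hy hyJ
    have : ∃ w ∈ p.support, w ∈ s(a, b) ∧ y = G.pos w := by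
      rcases hyJ with h | h
      · obtain ⟨w, rfl, hw, hw'⟩ := G.exists_eq_pos_of_mem_arc hf he hfe hy h
        exact ⟨w, huv w hw', hw, rfl⟩
      · exact exists_eq_pos_of_mem_walkCarrier hf hfp h hy
    obtain ⟨w, hw, hwf, rfl⟩ := this
    rcases Sym2.mem_iff.1 hwf with rfl | rfl
    · rfl
    · exact absurd hw hb
  have harc := G.arc_isArc a b hf
  have hba : G.pos b ≠ G.pos a := G.pos_injective.ne hf.ne'
  have hbJ : G.pos b ∉ G.arc s(u, v) ∪ G.walkCarrier p := fun h => hba (hinter _ harc.right_mem h)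
  -- Go from `z` to `b` along the edge with `a` removed, then from the exterior vertex `b` into the
  -- outer face.
  refine LogEquivOn.trans (LogEquivOn.of_isPreconnected hJ harc.isPreconnected_diff_left
    (fun y hy hyJ => hy.2 (hinter y hy.1 hyJ)) ⟨hz, fun h => hzp ⟨a, h.symm⟩⟩
    ⟨harc.right_mem, hba⟩) (LogEquivOn.of_isPreconnected hJ
      (S := insert (G.pos b) G.outerFace) ?_ ?_ (Set.mem_insert _ _)
      (Set.mem_insert_of_mem _ ho)) hbJ
  · exact G.isPreconnected_outerFace.subset_closure (Set.subset_insert _ _)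
      (Set.insert_subset (frontier_subset_closure hbx) subset_closure)
  · exact Set.insert_subset hbJ fun y hy hyJ => hy.1 (hJG hyJ)

/-- If all edges on the outer boundary belong to a spanning cycle whose vertices are exterior,
then no two chords of this cycle cross. -/
theorem false_of_crossing [Finite V] (G : PlaneGraph V) (hext : ∀ w, G.IsExterior w) {u v a b : V}
    {p q : G.graph.Walk u v} (hs : ∀ w, w ∈ p.support ∨ w ∈ q.support)
    (hpq : ∀ w, w ∈ p.support → w ∈ q.support → w = u ∨ w = v)
    (hout : ∀ f, G.IsOuterEdge f → f ∈ p.edges ∨ f ∈ q.edges)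
    (he : G.graph.Adj u v) (hep : s(u, v) ∉ p.edges)
    (hf : G.graph.Adj a b) (ha : a ∉ q.support) (hb : b ∉ p.support) : False := by
  obtain ⟨z, hz, hzp⟩ := G.exists_mem_arc_notMem_range (e := s(a, b)) hf
  obtain ⟨o, ho⟩ := G.outerFace_nonempty
  -- From its end `b` the edge avoids `uv` together with `p`; from its end `a` it avoids `uv`
  -- together with `q`. So `z` is equivalent to `o` with respect to both closed curves.
  have h₁ := G.logEquivOn_arc_union_walkCarrier he hf hb (hext b) hz hzp ho
  have h₂ := G.logEquivOn_arc_union_walkCarrier (p := q) he hf.symm ha (hext a)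
    (by rwa [Sym2.eq_swap]) hzp ho
  have harc := G.arc_isArc u v he
  have hinter : (G.arc s(u, v) ∪ G.walkCarrier p) ∩ (G.arc s(u, v) ∪ G.walkCarrier q) =
      G.arc s(u, v) := by
    rw [← Set.union_inter_distrib_left, Set.union_eq_left]
    rintro y ⟨hyp, hyq⟩
    have key : ∃ w ∈ p.support, w ∈ q.support ∧ y = G.pos w := by
      rcases mem_walkCarrier hyp with ⟨w, hw, rfl⟩ | ⟨f, hfp, hy⟩
      · rcases mem_walkCarrier hyq with ⟨w', hw', h⟩ | ⟨f, hfq, hy⟩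
        · exact ⟨w, hw, G.pos_injective h ▸ hw', rfl⟩
        · exact ⟨w, hw, q.mem_support_of_mem_edges hfq
            (G.mem_of_pos_mem_arc f (q.edges_subset_edgeSet hfq) w hy), rfl⟩
      -- A common edge would have both ends in `{u, v}`, so it would be `uv`, which is not in `p`.
      · have hfq : f ∉ q.edges := by
          intro hfq
          induction f with
          | h c d =>
            have hcd := (p.edges_subset_edgeSet hfp : G.graph.Adj c d).ne
            have hc := hpq c (p.fst_mem_support_of_mem_edges hfp)
              (q.fst_mem_support_of_mem_edges hfq)
            have hd := hpq d (p.snd_mem_support_of_mem_edges hfp)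
              (q.snd_mem_support_of_mem_edges hfq)
            rcases hc with rfl | rfl <;> rcases hd with rfl | rfl
            · exact hcd rfl
            · exact hep hfp
            · exact hep (Sym2.eq_swap ▸ hfp)
            · exact hcd rfl
        obtain ⟨w, hw, hwf, rfl⟩ :=
          exists_eq_pos_of_mem_walkCarrier (p.edges_subset_edgeSet hfp) hfq hyq hy
        exact ⟨w, p.mem_support_of_mem_edges hfp hwf, hw, rfl⟩
    obtain ⟨w, hwp, hwq, rfl⟩ := key
    rcases hpq w hwp hwq with rfl | rfl
    · exact harc.left_mem
    · exact harc.right_mem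
  have hpc := G.isCompact_walkCarrier p
  have hqc := G.isCompact_walkCarrier q
  -- The two curves share exactly the connected arc `uv`, so the logarithms glue; forgetting `uv`
  -- leaves the cycle, which contains the outer boundary. Hence `z` would lie in the outer face.
  have hlog : LogEquivOn (G.walkCarrier p ∪ G.walkCarrier q) z o :=
    (HasLogOn.union_of_isClosed h₁ h₂ (harc.isCompact.isClosed.union hpc.isClosed)
      (harc.isCompact.isClosed.union hqc.isClosed) (by rw [hinter]; exact harc.isPreconnected)).mono
      (Set.union_subset_union Set.subset_union_right Set.subset_union_right)
  have hzC : z ∉ G.walkCarrier p ∪ G.walkCarrier q := by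
    rintro (h | h)
    · obtain ⟨w, -, -, rfl⟩ := exists_eq_pos_of_mem_walkCarrier (e := s(a, b)) hf
        (fun h => hb (p.snd_mem_support_of_mem_edges h)) h hz
      exact hzp ⟨w, rfl⟩
    · obtain ⟨w, -, -, rfl⟩ := exists_eq_pos_of_mem_walkCarrier (e := s(a, b)) hf
        (fun h => ha (q.fst_mem_support_of_mem_edges h)) h hz
      exact hzp ⟨w, rfl⟩
  have hoC : o ∉ G.walkCarrier p ∪ G.walkCarrier q := fun h =>
    ho.1 (Set.union_subset (G.walkCarrier_subset_carrier p) (G.walkCarrier_subset_carrier q) h)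
  have hfr : frontier G.outerFace ⊆ G.walkCarrier p ∪ G.walkCarrier q := by
    intro y hy
    rcases G.mem_frontier_outerFace hy with ⟨w, rfl⟩ | ⟨f, hf, hyf⟩
    · exact (hs w).imp pos_mem_walkCarrier pos_mem_walkCarrier
    · exact (hout f hf).imp (fun h => arc_subset_walkCarrier h hyf)
        fun h => arc_subset_walkCarrier h hyf
  have hsub := (isPreconnected_connectedComponentIn
    (F := (G.walkCarrier p ∪ G.walkCarrier q)ᶜ) (x := o)).subset_of_disjoint_frontier
    G.isOpen_outerFace
    (Set.disjoint_left.2 fun y hy hy' => connectedComponentIn_subset _ _ hy (hfr hy'))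
    ⟨o, mem_connectedComponentIn hoC, ho⟩
  exact (hsub (hlog.symm.mem_connectedComponentIn (hpc.union hqc) hoC hzC)).1
    (G.arc_subset_carrier hf hz)

end PlaneGraph

/-! ### Hamiltonian cycles in abstract graphs -/

namespace SimpleGraph.Walk

variable {V : Type*} {G : SimpleGraph V}

theorem iff_of_mem_support {S : V → Prop} {a b : V} (p : G.Walk a b)
    (h : ∀ x y, G.Adj x y → x ∈ p.support → y ∈ p.support → (S x ↔ S y)) {z : V}
    (hz : z ∈ p.support) : S a ↔ S z := by
  induction p with
  | nil => rw [support_nil, List.mem_singleton] at hz; rw [hz]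
  | @cons a c b hac p ih =>
    rw [support_cons, List.mem_cons] at hz
    rcases hz with rfl | hz
    · rfl
    · refine (h a c hac (by simp) (by simp)).trans (ih (fun x y hxy hx hy => h x y hxy ?_ ?_) hz)
      · simp [hx]
      · simp [hy]

/-- The second vertex of `p` is neither `u` nor, as `p` avoids the edge `uv`, equal to `v`. -/
theorem exists_mem_support_notMem {u v : V} {p q : G.Walk u v} (huv : u ≠ v)
    (hpq : ∀ w, w ∈ p.support → w ∈ q.support → w = u ∨ w = v) (he : s(u, v) ∉ p.edges) :
    ∃ w, w ∉ q.support := by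
  by_contra! h
  cases p with
  | nil => exact huv rfl
  | @cons _ w _ hw p =>
    rcases hpq w (by simp) (h w) with rfl | rfl
    · exact hw.ne rfl
    · exact he (by simp)

variable [DecidableEq V]

/-- A Hamiltonian cycle consists of an edge at a given vertex and a Hamiltonian path. -/
theorem IsHamiltonianCycle.exists_path {a : V} {p : G.Walk a a} (hp : p.IsHamiltonianCycle)
    (v : V) : ∃ (w : V) (_ : G.Adj v w) (q : G.Walk w v), q.IsPath ∧ (∀ x, x ∈ q.support) ∧
      s(v, w) ∉ q.edges ∧ ∀ e, e ∈ p.edges ↔ e = s(v, w) ∨ e ∈ q.edges := by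
  have hr := hp.rotate (hp.mem_support v)
  have he := (rotate_edges p v (hp.mem_support v)).perm
  revert hr he
  generalize p.rotate v (hp.mem_support v) = r
  intro hr he
  cases r with
  | nil => exact absurd hr.isCycle.not_nil (by simp)
  | @cons _ w _ h q =>
    have hc := (cons_isCycle_iff q h).1 hr.isCycle
    refine ⟨w, h, q, hc.1, fun x => ?_, hc.2, fun e => ?_⟩
    · have := hr.mem_support x
      rw [support_cons, List.mem_cons] at this
      rcases this with rfl | h
      · exact q.end_mem_support
      · exact h
    · rw [← he.mem_iff, edges_cons, List.mem_cons]

/-- Cutting the cycle at `v` gives a spanning path ending at `v`; its initial segments connect all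
other vertices without using `v`. -/
theorem IsHamiltonianCycle.isTwoConnected [Finite V] {a : V} {p : G.Walk a a}
    (hp : p.IsHamiltonianCycle) : G.IsTwoConnected := by
  cases nonempty_fintype V
  refine ⟨?_, IsHamiltonian.connected fun _ => ⟨a, p, hp⟩, fun v => ?_⟩
  · rw [ENat.card_eq_coe_fintype_card, ← hp.length_eq]
    exact_mod_cast hp.isCycle.three_le_length
  · obtain ⟨w, hvw, q, hq, hs, -⟩ := hp.exists_path v
    rw [connected_iff_exists_forall_reachable]
    refine ⟨⟨w, hvw.ne'⟩, fun ⟨x, hx⟩ => ?_⟩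
    refine ⟨(q.takeUntil x (hs x)).induce _ fun y hy => ?_⟩
    rintro rfl
    exact endpoint_notMem_support_takeUntil hq (hs x) (Ne.symm hx) hy

/-- Two vertices split a Hamiltonian cycle into two walks. -/
theorem IsHamiltonianCycle.exists_split {a : V} {p : G.Walk a a} (hp : p.IsHamiltonianCycle)
    (u v : V) : ∃ q r : G.Walk u v, (∀ w, w ∈ q.support ∨ w ∈ r.support) ∧
      (∀ w, w ∈ q.support → w ∈ r.support → w = u ∨ w = v) ∧
      ∀ e, e ∈ p.edges ↔ e ∈ q.edges ∨ e ∈ r.edges := by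
  have hr := hp.rotate (hp.mem_support u)
  have he := (rotate_edges p u (hp.mem_support u)).perm
  revert hr he
  generalize p.rotate u (hp.mem_support u) = c
  intro hc he
  have hv := hc.mem_support v
  refine ⟨c.takeUntil v hv, (c.dropUntil v hv).reverse, fun w => ?_, fun w hw hw' => ?_,
    fun e => ?_⟩
  · have := hc.mem_support w
    rw [← c.take_spec hv, mem_support_append_iff] at this
    rwa [support_reverse, List.mem_reverse]
  · rw [support_reverse, List.mem_reverse] at hw'
    by_contra! hne
    have hn := hc.isCycle.support_nodup
    rw [← c.take_spec hv, tail_support_append] at hn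
    refine List.disjoint_of_nodup_append hn (a := w) ?_ ?_
    · rw [← cons_tail_support, List.mem_cons] at hw
      exact hw.resolve_left hne.1
    · rw [← cons_tail_support, List.mem_cons] at hw'
      exact hw'.resolve_left hne.2
  · rw [← he.mem_iff, edges_reverse, List.mem_reverse, ← List.mem_append, ← edges_append,
      take_spec]

/-- A Hamiltonian cycle through the edge `uv` yields a path that contains all vertices but `u` and
`v`. -/
theorem IsHamiltonianCycle.exists_path_of_mem_edges {a u v : V} {p : G.Walk a a}
    (hp : p.IsHamiltonianCycle) (he : s(u, v) ∈ p.edges) {x : V} (hxu : x ≠ u) (hxv : x ≠ v) :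
    ∃ (b c : V) (q : G.Walk b c), ∀ w, w ∈ q.support ↔ w ≠ u ∧ w ≠ v := by
  obtain ⟨w, huw, q, hq, hs, -, hpq⟩ := hp.exists_path u
  obtain ⟨y, r, hr, hru⟩ : ∃ (y : V) (r : G.Walk v y), r.IsPath ∧
      ∀ z, z ∈ r.support ↔ z ≠ u := by
    have hq' := hq.reverse
    have hs' : ∀ x, x ∈ q.reverse.support := by simpa using hs
    have hpq' : s(u, v) = s(u, w) ∨ s(u, v) ∈ q.reverse.edges := by simpa using (hpq _).1 he
    revert hq' hs' hpq'
    generalize q.reverse = t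
    intro hq' hs' hpq'
    cases t with
    | nil => exact absurd rfl huw.ne
    | @cons _ z _ h t =>
      rw [cons_isPath_iff] at hq'
      have hmem : ∀ z, z ∈ t.support ↔ z ≠ u := by
        refine fun z => ⟨fun hz h => hq'.2 (h ▸ hz), fun hz => ?_⟩
        have := hs' z
        rw [support_cons, List.mem_cons] at this
        exact this.resolve_left hz
      rw [edges_cons, List.mem_cons] at hpq'
      -- Removing `u` from the cycle leaves a path whose ends are the two cycle neighbours of `u`.
      -- As `uv` is a cycle edge, `v` is one of them, and the path is oriented to start there.
      rcases hpq' with h | h | h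
      · obtain rfl := Sym2.congr_right.1 h
        exact ⟨_, t.reverse, hq'.1.reverse, by simpa using hmem⟩
      · obtain rfl := Sym2.congr_right.1 h
        exact ⟨_, t, hq'.1, hmem⟩
      · exact absurd (t.fst_mem_support_of_mem_edges h) hq'.2
  cases r with
  | nil => exact absurd ((hru x).2 hxu) (by simpa using hxv)
  | @cons _ z _ h t =>
    rw [cons_isPath_iff] at hr
    refine ⟨_, _, t, fun z => ⟨fun hz => ⟨(hru z).1 (by simp [hz]), fun h => hr.2 (h ▸ hz)⟩,
      fun hz => ?_⟩⟩
    have := (hru z).2 hz.1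
    rw [support_cons, List.mem_cons] at this
    exact this.resolve_left hz.2

/-- Both cycles have as many edges as there are vertices, so the inclusion is an equality. -/
theorem toSubgraph_eq_of_edges_subset [Finite V] {a b : V} {p : G.Walk a a} {q : G.Walk b b}
    (hp : p.IsHamiltonianCycle) (hq : q.IsHamiltonianCycle) (h : q.edges ⊆ p.edges) :
    q.toSubgraph = p.toSubgraph := by
  cases nonempty_fintype V
  have hperm := (List.subperm_of_subset hq.isCycle.edges_nodup h).perm_of_length_le (by
    rw [length_edges, length_edges, hp.length_eq, hq.length_eq])
  ext x y
  · simp [hp.mem_support, hq.mem_support]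
  · rw [adj_toSubgraph_iff_mem_edges, adj_toSubgraph_iff_mem_edges, hperm.mem_iff]

end SimpleGraph.Walk

/-! ### The final graph and the deletion induction -/

namespace PlaneGraph

variable {V : Type*}

theorem deleteEdges_empty (G : PlaneGraph V) : G.deleteEdges ∅ = G := by
  cases G
  simp [deleteEdges]

theorem deleteEdges_deleteEdges (G : PlaneGraph V) (s t : Set (Sym2 V)) :
    (G.deleteEdges s).deleteEdges t = G.deleteEdges (s ∪ t) := by
  simp [deleteEdges, SimpleGraph.deleteEdges_deleteEdges]

theorem after_zero (G : PlaneGraph V) (E : List (Sym2 V)) : G.after E 0 = G := by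
  simpa [after] using G.deleteEdges_empty

/-- Peels off the first deletion, so that a sequence for the smaller graph can be extended at its
front. -/
theorem after_cons_succ (G : PlaneGraph V) (e : Sym2 V) (E : List (Sym2 V)) (t : ℕ) :
    G.after (e :: E) (t + 1) = (G.deleteEdges {e}).after E t := by
  rw [after, after, deleteEdges_deleteEdges]
  congr 1
  ext f
  simp

variable [DecidableEq V] [Finite V]

section FinalGraph

variable {G : PlaneGraph V} {a : V} {p : G.graph.Walk a a}

theorem isExterior_of_isHamiltonianCycle (hp : p.IsHamiltonianCycle)
    (hout : ∀ e, G.IsOuterEdge e → e ∈ p.edges) (v : V) : G.IsExterior v := by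
  obtain ⟨w, hvw, q, hq, hs, hvq, hpq⟩ := hp.exists_path v
  have := G.isOuterEdge_of_isPath hq hs (e := s(v, w)) hvw hvq fun f hf => (hpq f).1 (hout f hf)
  exact this.2 (G.arc_isArc v w hvw).left_mem

theorem toSubgraph_eq_of_isHamiltonianCycle (hp : p.IsHamiltonianCycle)
    (hout : ∀ e, G.IsOuterEdge e → e ∈ p.edges) {b : V} {d : G.graph.Walk b b}
    (hd : d.IsHamiltonianCycle) : d.toSubgraph = p.toSubgraph := by
  refine SimpleGraph.Walk.toSubgraph_eq_of_edges_subset hp hd fun e he => ?_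
  by_contra hep
  induction e with
  | h u v =>
    have huv : G.graph.Adj u v := d.edges_subset_edgeSet he
    obtain ⟨q, r, hs, hqr, hedge⟩ := hp.exists_split u v
    rw [hedge, not_or] at hep
    obtain ⟨x, hx⟩ := SimpleGraph.Walk.exists_mem_support_notMem huv.ne hqr hep.1
    obtain ⟨y, hy⟩ := SimpleGraph.Walk.exists_mem_support_notMem huv.ne
      (fun w h h' => hqr w h' h) hep.2
    have hne : ∀ {w} {s : G.graph.Walk u v}, w ∉ s.support → w ≠ u ∧ w ≠ v := fun {w s} hw =>
      ⟨fun h => hw (h ▸ s.start_mem_support), fun h => hw (h ▸ s.end_mem_support)⟩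
    -- The edge `uv` of `d` is a chord of `p` with a vertex strictly on each side. As `uv` lies on
    -- `d`, removing `u` and `v` leaves `d` in one piece, the walk `t`.
    obtain ⟨c, c', t, ht⟩ := hd.exists_path_of_mem_edges he (hne hx).1 (hne hx).2
    have hcross : ∀ a b, G.graph.Adj a b → a ∉ r.support → b ∈ q.support := by
      intro a b hab ha
      by_contra hb
      exact G.false_of_crossing (isExterior_of_isHamiltonianCycle hp hout) hs hqr
        (fun f hf => (hedge f).1 (hout f hf)) huv hep.1 hab ha hb
    have hstep : ∀ a b, G.graph.Adj a b → b ∈ t.support → a ∉ r.support → b ∉ r.support := by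
      intro a b hab hb ha hbr
      have := (ht b).1 hb
      rcases hqr b (hcross a b hab ha) hbr with h | h
      · exact this.1 h
      · exact this.2 h
    -- No edge of `t` crosses the chord, so `t` stays on one side of it, although it visits both `x`
    -- and `y`.
    have hiff : ∀ z ∈ t.support, (c ∉ r.support ↔ z ∉ r.support) := fun z hz =>
      t.iff_of_mem_support (S := fun w => w ∉ r.support) (fun a b hab ha hb =>
        ⟨hstep a b hab hb, hstep b a hab.symm ha⟩) hz
    have hyr := (hiff y ((ht y).2 (hne hy))).1 ((hiff x ((ht x).2 (hne hx))).2 hx)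
    exact (hs y).elim hy hyr

end FinalGraph

/-- Induction on a bound for the number of edges, with the graph and its cycle varying: either all
outer edges lie on the cycle and the empty sequence works, or an outer edge off the cycle can be
deleted first. -/
theorem exists_isCoHamiltonianEdgeSeq (n : ℕ) : ∀ (G : PlaneGraph V), G.graph.edgeSet.ncard ≤ n →
    ∀ {a : V} {p : G.graph.Walk a a}, p.IsHamiltonianCycle →
      ∃ E L, G.IsCoHamiltonianEdgeSeq E ∧ G.IsInducedFaceSeq E L := by
  induction n with
  | zero =>
    intro G hG a p hp
    obtain ⟨w, h, -⟩ := hp.exists_path a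
    rw [Nat.le_zero, Set.ncard_eq_zero] at hG
    have h' : s(a, w) ∈ G.graph.edgeSet := h
    rw [hG] at h'
    exact h'.elim
  | succ n ih =>
    intro G hG a p hp
    by_cases hout : ∀ e, G.IsOuterEdge e → e ∈ p.edges
    · refine ⟨[], [], ⟨by simp, by simp, ?_, ?_⟩, ⟨rfl, by simp, by simp⟩⟩
      · rw [List.length_nil, after_zero]
        exact isExterior_of_isHamiltonianCycle hp hout
      · rw [List.length_nil, after_zero]
        refine ⟨p.toSubgraph, ⟨a, p, hp, rfl⟩, ?_⟩
        rintro _ ⟨b, d, hd, rfl⟩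
        exact toSubgraph_eq_of_isHamiltonianCycle hp hout hd
    push Not at hout
    obtain ⟨e, he, hep⟩ := hout
    have hp' : (p.toDeleteEdges {e} fun f hf hfe => hep (Set.mem_singleton_iff.1 hfe ▸ hf) :
        (G.deleteEdges {e}).graph.Walk a a).IsHamiltonianCycle := by
      cases nonempty_fintype V
      rw [SimpleGraph.Walk.isHamiltonianCycle_iff_isCycle_and_length_eq]
      exact ⟨hp.isCycle.toDeleteEdges _ _ _, by simp [hp.length_eq]⟩
    -- Besides the 2-connectedness condition, this gives a path between the ends of the deleted
    -- edge, as needed to find the merged face.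
    have htwo := hp'.isTwoConnected
    obtain ⟨E, L, hE, hL⟩ := ih (G.deleteEdges {e}) (by
      have : (G.deleteEdges {e}).graph.edgeSet.ncard < G.graph.edgeSet.ncard := by
        refine Set.ncard_lt_ncard ?_ (Set.toFinite _)
        rw [deleteEdges, SimpleGraph.edgeSet_deleteEdges]
        exact Set.sdiff_singleton_ssubset.2 he.1
      omega) hp'
    obtain ⟨F, hF, hFO⟩ : ∃ F, G.IsBoundedFace F ∧ F ⊆ (G.deleteEdges {e}).outerFace := by
      induction e with
      | h u v =>
        obtain ⟨q⟩ := htwo.connected.preconnected u v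
        exact G.exists_isBoundedFace_subset he q.bypass_isPath
    refine ⟨e :: E, F :: L, ⟨fun t ht => ?_, fun t ht => ?_, ?_, ?_⟩, ⟨by simp [hL.length_eq],
      fun t ht => ?_, fun t ht => ?_⟩⟩
    · cases t with
      | zero => rwa [after_zero]
      | succ t => rw [after_cons_succ]; exact hE.outer t (by simpa using ht)
    · rw [after_cons_succ]
      cases t with
      | zero => rwa [after_zero]
      | succ t => exact hE.twoConnected t (by simpa using ht)
    · rw [List.length_cons, after_cons_succ]
      exact hE.exterior
    · rw [List.length_cons, after_cons_succ]
      exact hE.unique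
    · cases t with
      | zero => rwa [after_zero]
      | succ t => rw [after_cons_succ]; exact hL.bounded t (by simpa using ht)
    · rw [after_cons_succ]
      cases t with
      | zero => rwa [after_zero]
      | succ t => exact hL.merged t (by simpa using ht)

end PlaneGraph

theorem mainTheorem6 {V : Type*} [Finite V] [DecidableEq V] (G : PlaneGraph V)
    (hG : G.graph.IsTwoConnected) :
    (∃ C : G.graph.Subgraph, G.graph.IsHamiltonianCircle C) ↔
      ∃ L : List (Set Plane), G.IsCoHamiltonianFaceSeq L := by
  constructor
  · rintro ⟨_, a, p, hp, -⟩
    obtain ⟨E, L, hE, hL⟩ := PlaneGraph.exists_isCoHamiltonianEdgeSeq _ G le_rfl hp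
    exact ⟨L, E, hE, hL⟩
  · rintro ⟨L, E, hE, -⟩
    obtain ⟨_, ⟨a, p, hp, -⟩, -⟩ := hE.unique
    exact ⟨_, a, p.map (SimpleGraph.Hom.ofLE (SimpleGraph.deleteEdges_le _)),
      hp.map Function.bijective_id, rfl⟩
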